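/- Let $d\ge 1$, $m\ge 0$ be integers, $A$ a real $d\times d$ matrix, $\delta>0$, $\theta$ a probability measure on $\mathbb{R}^m$, and $f:\mathbb{R}^d\times\mathcal{P}(\mathbb{R}^d)\times\mathbb{R}^m\to\mathbb{R}^d$ a measurable map, where the set $\mathcal{P}(\mathbb{R}^d)$ of Borel probability measures carries the Borel $\sigma$-field of the weak topology. Let $|\cdot|$ be the Euclidean norm, $\|A\|=\sup_{x\neq 0}|Ax|/|x|$, $\mathcal{P}_1(\mathbb{R}^d)=\{\mu\in\mathcal{P}(\mathbb{R}^d):\int|x|\,d\mu<\infty\}$, and let $\mathcal{W}_1(\mu,\nu)=\inf E|X-Y|$, over all couplings $(X,Y)$ of $\mu$ and $\nu$, be the Wasserstein-1 distance. Let $\mu_0\in\mathcal{P}_1(\mathbb{R}^d)$. The laws of the nonlinear Markov chain are defined by $\mu_{n+1}=\Psi(\mu_n)$, where $\Psi(\mu)$ is the law of $AX+\delta f(X,\mu,\epsilon)$ for $(X,\epsilon)\sim\mu\otimes\theta$. For each $N\ge1$ the $N$-particle system is $$X_{n+1}^{i}=AX_n^{i}+\delta f(X_n^{i},\mu_n^N,\epsilon_{n+1}^{i}),\qquad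 \mu_n^N=\frac1N\sum_{j=1}^N\delta_{X_n^{j}},\qquad 1\le i\le N,\ n\ge 0,$$ where $X_0^{1},\dots,X_0^{N}$ are exchangeable with common law $\mu_0$, and $\{\epsilon_n^i\}_{n\ge1,\,1\le i\le N}$ are i.i.d. with law $\theta$ and independent of $(X_0^{1},\dots,X_0^{N})$. Put $$D(z)=\sup\left\{\frac{|f(x_1,\nu_1,z)-f(x_2,\nu_2,z)|}{|x_1-x_2|+\mathcal{W}_1(\nu_1,\nu_2)}:\ x_1\ne x_2\in\mathbb{R}^d,\ \nu_1\neq\nu_2\in\mathcal{P}_1(\mathbb{R}^d)\right\},\qquad D_1(z)=|f(0,\delta_0,z)|.$$ Assume that $\|A\|\le e^{-\omega}$ for some $\omega>0$, and that for some $\alpha>0$ $$\int|x|^{1+\alpha}\mu_0(dx)<\infty,\qquad \sigma_1:=\int D(z)^{1+\alpha}\,\theta(dz)<\infty,\qquad \int D_1(z)^{1+\alpha}\,\theta(dz)<\infty.$$ Let $\sigma=\int D\,d\theta$ and assume $\sigma>0$. Set $$a_0=\frac{1-e^{-\omega}}{2\sigma},\qquad a=\frac{4^{-\alpha}-e^{-(1+\alpha)\omega}}{2\sigma_1},$$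 and assume $a>0$. Fix $\gamma_0\in(0,a_0)$, suppose that $\delta\in\bigl(0,\min\{a^{1/(1+\alpha)},\,a_0-\gamma_0\}\bigr)$, and let $$\vartheta=\frac{1-2\sigma\gamma_0}{e^{-\omega}+2\delta\sigma}.$$ Then there exist $N_0\in\mathbb{N}_0$ and $C_1\in(0,\infty)$ such that for all $\varepsilon>0$, all $n\ge0$, all $N\ge 1$ with $N>N_0\bigl(\max\{1,\log^+\varepsilon\}\bigr)^{(d+2)/d}$, and every $N$-particle system as above, $$P\bigl(\mathcal{W}_1(\mu_n^N,\mu_n)>\varepsilon\bigr)\le P\bigl(\mathcal{W}_1(\mu_0^N,\mu_0)>2\sigma\gamma_0\vartheta^n\varepsilon\bigr)+C_1\,\varepsilon^{-(1+\alpha)}N^{-\frac{\alpha}{d+2}}.$$ -/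

import Mathlib

open MeasureTheory ProbabilityTheory
open scoped ENNReal NNReal

noncomputable section

namespace WeakInteraction

/-- `ℝ^k` with the Euclidean norm and its Borel σ-field. -/
abbrev E (k : ℕ) : Type := EuclideanSpace ℝ (Fin k)

/-- Membership in `𝒫₁(ℝ^d)`: finite first absolute moment. -/
def FiniteFirstMoment {d : ℕ} (μ : ProbabilityMeasure (E d)) : Prop :=
  ∫⁻ x, ‖x‖ₑ ∂(μ : Measure (E d)) < ∞

/-- Couplings of `μ` and `ν`: joint laws of pairs `(X, Y)` with `X ∼ μ` and `Y ∼ ν`. -/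
def couplings {d : ℕ} (μ ν : ProbabilityMeasure (E d)) : Set (Measure (E d × E d)) :=
  {π | π.map Prod.fst = (μ : Measure (E d)) ∧ π.map Prod.snd = (ν : Measure (E d))}

/-- The Wasserstein-1 distance `inf E|X - Y|` over all couplings, as an extended nonnegative real
(it is finite when both measures have finite first moment). -/
def W1 {d : ℕ} (μ ν : ProbabilityMeasure (E d)) : ℝ≥0∞ :=
  ⨅ π ∈ couplings μ ν, ∫⁻ p, edist p.1 p.2 ∂π

/-- The empirical measure `(1/N) ∑ δ_{x_i}` of `N ≥ 1` points. -/
def empirical {d N : ℕ} [NeZero N] (x : Fin N → E d) : ProbabilityMeasure (E d) :=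
  ⟨(N : ℝ≥0∞)⁻¹ • ∑ i, Measure.dirac (x i), ⟨by
    simp [ENNReal.inv_mul_cancel (Nat.cast_ne_zero.mpr (NeZero.ne N)) (ENNReal.natCast_ne_top N)]⟩⟩

/-- The data of the dynamics `x ↦ A x + δ f(x, ρ, z)` with noise `z ∼ θ`.
The σ-field on `ProbabilityMeasure (E d)` is the one generated by the evaluations
`ρ ↦ ρ B`, which is the Borel σ-field of the weak topology. -/
structure Model (d m : ℕ) where
  A : Matrix (Fin d) (Fin d) ℝ
  δ : ℝ
  f : E d → ProbabilityMeasure (E d) → E m → E d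
  measurable_f : Measurable fun p : E d × ProbabilityMeasure (E d) × E m => f p.1 p.2.1 p.2.2
  θ : ProbabilityMeasure (E m)

namespace Model

variable {d m : ℕ} (M : Model d m)

/-- The matrix `A` as an operator on Euclidean space; its norm is `sup_{x ≠ 0} |A x| / |x|`. -/
def opA : E d →L[ℝ] E d := Matrix.toEuclideanCLM (𝕜 := ℝ) M.A

/-- One step of the dynamics. -/
def step (ρ : ProbabilityMeasure (E d)) (x : E d) (z : E m) : E d :=
  M.opA x + M.δ • M.f x ρ z

theorem measurable_step (ρ : ProbabilityMeasure (E d)) :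
    Measurable fun p : E d × E m => M.step ρ p.1 p.2 := by
  have h : Measurable fun p : E d × E m => M.f p.1 ρ p.2 :=
    M.measurable_f.comp
      (measurable_fst.prodMk (measurable_const.prodMk measurable_snd))
  exact (M.opA.continuous.measurable.comp measurable_fst).add (h.const_smul M.δ)

/-- `Ψ(μ) = μ P^μ`, the law of `A X + δ f(X, μ, ε)` when `(X, ε) ∼ μ ⊗ θ`. -/
def Psi (μ : ProbabilityMeasure (E d)) : ProbabilityMeasure (E d) :=
  (μ.prod M.θ).map (M.measurable_step μ).aemeasurable

/-- The laws `μ_n` of the nonlinear Markov chain: `μ_{n+1} = Ψ(μ_n)`. -/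
def law (μ₀ : ProbabilityMeasure (E d)) : ℕ → ProbabilityMeasure (E d)
  | 0 => μ₀
  | n + 1 => M.Psi (law μ₀ n)

/-- The random Lipschitz constant `D(z)` of `f(·, ·, z)` on `ℝ^d × 𝒫₁(ℝ^d)`. -/
def D (z : E m) : ℝ≥0∞ :=
  ⨆ (x₁ : E d) (x₂ : E d) (ρ₁ : ProbabilityMeasure (E d)) (ρ₂ : ProbabilityMeasure (E d))
    (_ : x₁ ≠ x₂) (_ : ρ₁ ≠ ρ₂) (_ : FiniteFirstMoment ρ₁) (_ : FiniteFirstMoment ρ₂),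
    edist (M.f x₁ ρ₁ z) (M.f x₂ ρ₂ z) / (edist x₁ x₂ + W1 ρ₁ ρ₂)

/-- `D₁(z) = |f(0, δ₀, z)|`. -/
def D₁ (z : E m) : ℝ≥0∞ := ‖M.f 0 (diracProba 0) z‖ₑ

/-- `σ = ∫ D dθ`. -/
def σ : ℝ := (∫⁻ z, M.D z ∂(M.θ : Measure (E m))).toReal

/-- `σ₁(α) = ∫ D^{1+α} dθ`. -/
def σ₁ (α : ℝ) : ℝ := (∫⁻ z, M.D z ^ (1 + α) ∂(M.θ : Measure (E m))).toReal

/-- The moment assumption of order `1 + α` on the initial law and on the noise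
(with `D` measurable modulo `θ`-null sets, so that its integrals make sense). -/
structure MomentAssumption (α : ℝ) (μ₀ : ProbabilityMeasure (E d)) : Prop where
  aemeasurable_D : AEMeasurable M.D (M.θ : Measure (E m))
  init : ∫⁻ x, ‖x‖ₑ ^ (1 + α) ∂(μ₀ : Measure (E d)) < ∞
  lip : ∫⁻ z, M.D z ^ (1 + α) ∂(M.θ : Measure (E m)) < ∞
  base : ∫⁻ z, M.D₁ z ^ (1 + α) ∂(M.θ : Measure (E m)) < ∞

/-- `a₀ = (1 - e^{-ω}) / (2σ)`. -/
def a₀ (ω : ℝ) : ℝ := (1 - Real.exp (-ω)) / (2 * M.σ)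

/-- `a(α) = (4^{-α} - e^{-(1+α)ω}) / (2σ₁(α))`. -/
def a (ω α : ℝ) : ℝ := ((4 : ℝ) ^ (-α) - Real.exp (-(1 + α) * ω)) / (2 * M.σ₁ α)

/-- `ϑ = (1 - 2σγ₀) / (e^{-ω} + 2δσ)`. -/
def vartheta (ω γ₀ : ℝ) : ℝ :=
  (1 - 2 * M.σ * γ₀) / (Real.exp (-ω) + 2 * M.δ * M.σ)

/-- `X` is the `N`-particle system driven by the noise `ξ`, where `ξ n i` is the noise
`ε_{n+1}^i` that moves particle `i` from time `n` to time `n + 1`. The initial positions are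
exchangeable with common law `μ₀`; the noise array is i.i.d. with law `θ` and independent of
the initial positions. -/
structure IsParticleSystem {N : ℕ} [NeZero N] (μ₀ : ProbabilityMeasure (E d))
    {Ω : Type*} [MeasurableSpace Ω] (P : Measure Ω)
    (X : ℕ → Fin N → Ω → E d) (ξ : ℕ → Fin N → Ω → E m) : Prop where
  measurable_init : ∀ i, Measurable (X 0 i)
  measurable_noise : ∀ n i, Measurable (ξ n i)
  exchangeable : ∀ s : Equiv.Perm (Fin N),
    P.map (fun ω i => X 0 (s i) ω) = P.map (fun ω i => X 0 i ω)
  law_init : ∀ i, P.map (X 0 i) = (μ₀ : Measure (E d))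
  law_noise : ∀ n i, P.map (ξ n i) = (M.θ : Measure (E m))
  indep_noise : iIndepFun (fun (p : ℕ × Fin N) => ξ p.1 p.2) P
  indep_init_noise : IndepFun (fun ω i => X 0 i ω) (fun ω (p : ℕ × Fin N) => ξ p.1 p.2 ω) P
  dynamics : ∀ n i ω, X (n + 1) i ω = M.step (empirical fun j => X n j ω) (X n i ω) (ξ n i ω)

end Model

end WeakInteraction

end

/-! The error after one more step has two sources, separated by the triangle inequality through
`M.Psi (empirical x)`, where `x` is the configuration at time `n`. The propagated error is
deterministic: `W1_Psi_le` shows that `Psi` is Lipschitz for `W1` with constant `κ = e^{-ω} + 2δσ`.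
The fresh sampling error is controlled by `exists_one_step_bound`, with a tail `C N^{-α/(d+2)}
η^{-(1+α)}` uniform in `n` and `N`. Put `g = 2σγ₀`. Since `κϑ = 1 - g`, the level `ε` splits as `gε
+ κ(ϑε)`: the sampling error gets `gε`, and the old error is asked to stay below `ϑε`. Iterating
raises the level by `ϑ > 1` each time, so the tails sum as a geometric series of ratio `ϑ^{-(1+α)}`.

For the sampling error, freeze the positions at time `n`. The next positions are then independent,
though not identically distributed, and the average of their laws is `M.Psi (empirical x)`. The
distance between their empirical measure and this average is bounded by an explicit measurable
quantity, `gap`: truncate at radius `R`, round to a grid, and compare cell frequencies. Its moment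
of order `1 + α` is estimated by `lintegral_gap_rpow_le`, with a Rosenthal inequality for the
truncated tails and a Hoeffding bound over all sign patterns of the cells for the frequencies.
Choosing radius and mesh as powers of `N` gives the rate `N^{-α/(d+2)}` in
`exists_lintegral_gap_rpow_le`.

That estimate is for laws of averaged moment at most one, so each configuration is rescaled by its
own conditional moment (`stepGap`). Averaging over configurations then needs moments of the
particles bounded in `n` and `N`. This is `exists_avgPow_bound`, an affine recursion whose factor is
below one exactly by the condition on `δ^{1+α}`. Markov's inequality concludes. -/

namespace WeakInteraction

/-! ### Couplings and the Wasserstein distance -/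

section Wasserstein

variable {d : ℕ}

theorem W1_le_of_coupling {μ ν : ProbabilityMeasure (E d)} {π : Measure (E d × E d)}
    (hπ : π ∈ couplings μ ν) : W1 μ ν ≤ ∫⁻ p, edist p.1 p.2 ∂π :=
  iInf₂_le π hπ

theorem W1_le_lintegral_edist {S : Type*} [MeasurableSpace S] {P : Measure S} {g₁ g₂ : S → E d}
    (h₁ : Measurable g₁) (h₂ : Measurable g₂) {μ ν : ProbabilityMeasure (E d)}
    (hμ : P.map g₁ = μ) (hν : P.map g₂ = ν) :
    W1 μ ν ≤ ∫⁻ s, edist (g₁ s) (g₂ s) ∂P := by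
  have hm : Measurable fun s => (g₁ s, g₂ s) := h₁.prodMk h₂
  have h : P.map (fun s => (g₁ s, g₂ s)) ∈ couplings μ ν := by
    refine ⟨?_, ?_⟩
    · rw [Measure.map_map measurable_fst hm]; exact hμ
    · rw [Measure.map_map measurable_snd hm]; exact hν
  refine (W1_le_of_coupling h).trans ?_
  rw [lintegral_map (by fun_prop) hm]

theorem isProbabilityMeasure_of_coupling {μ ν : ProbabilityMeasure (E d)} {π : Measure (E d × E d)}
    (hπ : π ∈ couplings μ ν) : IsProbabilityMeasure π := by
  have h : IsProbabilityMeasure (π.map Prod.fst) := by rw [hπ.1]; infer_instance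
  constructor
  have h1 := h.measure_univ
  rwa [Measure.map_apply measurable_fst MeasurableSet.univ, Set.preimage_univ] at h1

/-- Gluing of couplings along their common marginal. -/
theorem W1_triangle (μ ν ρ : ProbabilityMeasure (E d)) : W1 μ ρ ≤ W1 μ ν + W1 ν ρ := by
  have key : ∀ π₁ ∈ couplings μ ν, ∀ π₂ ∈ couplings ν ρ,
      W1 μ ρ ≤ (∫⁻ p, edist p.1 p.2 ∂π₁) + ∫⁻ p, edist p.1 p.2 ∂π₂ := by
    intro π₁ h₁ π₂ h₂
    have := isProbabilityMeasure_of_coupling h₁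
    have := isProbabilityMeasure_of_coupling h₂
    have : IsProbabilityMeasure (π₁.map Prod.swap) :=
      Measure.isProbabilityMeasure_map measurable_swap.aemeasurable
    -- The swap puts the common marginal `ν` first in both couplings, so that both disintegrate over
    -- it.
    set τ := π₁.map Prod.swap with hτ
    have hτν : τ.fst = ν := by
      rw [Measure.fst, hτ, Measure.map_map measurable_fst measurable_swap]; exact h₁.2
    have hπν : π₂.fst = ν := h₂.1
    have e₁ : (ν : Measure (E d)) ⊗ₘ τ.condKernel = τ := by rw [← hτν]; exact τ.disintegrate _
    have e₂ : (ν : Measure (E d)) ⊗ₘ π₂.condKernel = π₂ := by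
      rw [← hπν]; exact π₂.disintegrate _
    -- Given the middle point, the two outer points are drawn independently from the conditional
    -- laws.
    let G : Measure (E d × (E d × E d)) := (ν : Measure (E d)) ⊗ₘ (τ.condKernel ×ₖ π₂.condKernel)
    have m₁ : G.map (fun q => (q.1, q.2.1)) = τ := by
      conv_rhs => rw [← e₁]
      ext s hs
      rw [Measure.map_apply (by fun_prop) hs, Measure.compProd_apply (hs.preimage (by fun_prop)),
        Measure.compProd_apply hs]
      refine lintegral_congr fun a => ?_
      rw [Kernel.prod_apply]
      have : (Prod.mk a ⁻¹' ((fun q : E d × (E d × E d) => (q.1, q.2.1)) ⁻¹' s))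
          = (Prod.mk a ⁻¹' s) ×ˢ Set.univ := by ext; simp
      rw [this, Measure.prod_prod]; simp
    have m₂ : G.map (fun q => (q.1, q.2.2)) = π₂ := by
      conv_rhs => rw [← e₂]
      ext s hs
      rw [Measure.map_apply (by fun_prop) hs, Measure.compProd_apply (hs.preimage (by fun_prop)),
        Measure.compProd_apply hs]
      refine lintegral_congr fun a => ?_
      rw [Kernel.prod_apply]
      have : (Prod.mk a ⁻¹' ((fun q : E d × (E d × E d) => (q.1, q.2.2)) ⁻¹' s))
          = Set.univ ×ˢ (Prod.mk a ⁻¹' s) := by ext; simp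
      rw [this, Measure.prod_prod]; simp
    have hμ : G.map (fun q => q.2.1) = μ := by
      have : (fun q : E d × (E d × E d) => q.2.1) = Prod.snd ∘ fun q => (q.1, q.2.1) := rfl
      rw [this, ← Measure.map_map measurable_snd (by fun_prop), m₁, hτ,
        Measure.map_map measurable_snd measurable_swap]
      exact h₁.1
    have hρ : G.map (fun q => q.2.2) = ρ := by
      have : (fun q : E d × (E d × E d) => q.2.2) = Prod.snd ∘ fun q => (q.1, q.2.2) := rfl
      rw [this, ← Measure.map_map measurable_snd (by fun_prop), m₂]
      exact h₂.2
    refine (W1_le_lintegral_edist (by fun_prop) (by fun_prop) hμ hρ).trans ?_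
    calc ∫⁻ q, edist q.2.1 q.2.2 ∂G
        ≤ ∫⁻ q, (edist q.2.1 q.1 + edist q.1 q.2.2) ∂G :=
          lintegral_mono fun q => edist_triangle _ _ _
      _ = (∫⁻ q, edist q.2.1 q.1 ∂G) + ∫⁻ q, edist q.1 q.2.2 ∂G :=
          lintegral_add_left (by fun_prop) _
      _ = _ := by
          congr 1
          · have : ∫⁻ p, edist p.2 p.1 ∂τ = ∫⁻ p, edist p.1 p.2 ∂π₁ := by
              rw [hτ, lintegral_map (by fun_prop) measurable_swap]; rfl
            rw [← this, ← m₁, lintegral_map (by fun_prop) (by fun_prop)]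
          · conv_rhs => rw [← m₂]
            rw [lintegral_map (by fun_prop) (by fun_prop)]
  unfold W1 at *
  rw [ENNReal.iInf_add]
  refine le_iInf fun π₁ => ?_
  by_cases h₁ : π₁ ∈ couplings μ ν
  · simp only [h₁, iInf_pos]
    rw [ENNReal.add_iInf]
    refine le_iInf fun π₂ => ?_
    by_cases h₂ : π₂ ∈ couplings ν ρ
    · simp only [h₂, iInf_pos]; exact key π₁ h₁ π₂ h₂
    · simp [h₂]
  · simp [h₁]

/-- Every coupling dilates along with its marginals. This undoes the normalization of a
configuration in `W1_le_stepGap`. -/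
theorem W1_map_smul_le {c : ℝ} (hc : c ≠ 0) {μ ν μ' ν' : ProbabilityMeasure (E d)}
    (hμ : (μ : Measure (E d)).map (c • ·) = μ') (hν : (ν : Measure (E d)).map (c • ·) = ν') :
    W1 μ' ν' ≤ ‖c‖ₑ * W1 μ ν := by
  conv_rhs => rw [W1, ENNReal.mul_iInf_of_ne (by simpa using hc) (by simp)]
  refine le_iInf fun π => ?_
  rw [ENNReal.mul_iInf_of_ne (by simpa using hc) (by simp)]
  refine le_iInf fun hπ => ?_
  have h₁ : π.map (fun p => c • p.1) = μ' := by
    rw [← hμ, ← hπ.1, Measure.map_map (by fun_prop) (by fun_prop)]; rfl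
  have h₂ : π.map (fun p => c • p.2) = ν' := by
    rw [← hν, ← hπ.2, Measure.map_map (by fun_prop) (by fun_prop)]; rfl
  refine (W1_le_lintegral_edist (by fun_prop) (by fun_prop) h₁ h₂).trans_eq ?_
  rw [← lintegral_const_mul _ (by fun_prop)]
  refine lintegral_congr fun p => ?_
  rw [edist_eq_enorm_sub, edist_eq_enorm_sub, ← smul_sub, enorm_smul]

/-- The shared mass `m` stays where it is. The excesses `a` and `b` have equal mass and are coupled
by their normalized product, at cost `|x - y| ≤ |x| + |y|`. -/
theorem W1_le_of_decomposition {μ ν : ProbabilityMeasure (E d)} {m a b : Measure (E d)}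
    [IsFiniteMeasure a] [IsFiniteMeasure b]
    (hμ : (μ : Measure (E d)) = m + a) (hν : (ν : Measure (E d)) = m + b) :
    W1 μ ν ≤ (∫⁻ x, ‖x‖ₑ ∂a) + ∫⁻ x, ‖x‖ₑ ∂b := by
  have hm : m Set.univ ≠ ∞ := by
    have h := congrArg (fun τ : Measure (E d) => τ Set.univ) hμ
    simp only [measure_univ, Measure.coe_add, Pi.add_apply] at h
    exact ne_top_of_le_ne_top ENNReal.one_ne_top (h ▸ le_self_add)
  have hab : a Set.univ = b Set.univ := by
    have h1 := congrArg (fun τ : Measure (E d) => τ Set.univ) hμ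
    have h2 := congrArg (fun τ : Measure (E d) => τ Set.univ) hν
    simp only [measure_univ, Measure.coe_add, Pi.add_apply] at h1 h2
    exact (ENNReal.add_right_inj hm).1 (h1.symm.trans h2)
  by_cases h0 : a Set.univ = 0
  · have ha : a = 0 := Measure.measure_univ_eq_zero.1 h0
    have hb : b = 0 := Measure.measure_univ_eq_zero.1 (hab ▸ h0)
    subst ha hb
    refine (W1_le_lintegral_edist (P := m) measurable_id measurable_id (by simpa using hμ.symm)
      (by simpa using hν.symm)).trans (by simp)
  have ht : a Set.univ ≠ ∞ := measure_ne_top _ _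
  have c1 : (a Set.univ)⁻¹ • (a Set.univ • b) = b := by
    rw [smul_smul, ENNReal.inv_mul_cancel h0 ht, one_smul]
  have c2 : (a Set.univ)⁻¹ • (b Set.univ • a) = a := by
    rw [← hab, smul_smul, ENNReal.inv_mul_cancel h0 ht, one_smul]
  let π : Measure (E d × E d) := m.map (fun x => (x, x)) + (a Set.univ)⁻¹ • a.prod b
  have hπ : π ∈ couplings μ ν := by
    constructor
    · rw [Measure.map_add _ _ measurable_fst, Measure.map_map (by fun_prop) (by fun_prop),
        Measure.map_smul, Measure.map_fst_prod, c2, hμ]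
      congr 1; exact Measure.map_id
    · rw [Measure.map_add _ _ measurable_snd, Measure.map_map (by fun_prop) (by fun_prop),
        Measure.map_smul, Measure.map_snd_prod, c1, hν]
      congr 1; exact Measure.map_id
  refine (W1_le_of_coupling hπ).trans ?_
  rw [lintegral_add_measure, lintegral_map (by fun_prop) (by fun_prop), lintegral_smul_measure]
  simp only [edist_self, lintegral_zero, zero_add]
  have h2 : ∫⁻ s, edist s.1 s.2 ∂(a.prod b) ≤ ∫⁻ s, (‖s.1‖ₑ + ‖s.2‖ₑ) ∂(a.prod b) :=
    lintegral_mono fun s => by rw [edist_eq_enorm_sub]; exact enorm_sub_le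
  refine (mul_le_mul_right h2 _).trans_eq ?_
  rw [lintegral_add_left (by fun_prop), lintegral_prod _ (by fun_prop),
    lintegral_prod _ (by fun_prop)]
  simp only [lintegral_const]
  rw [lintegral_mul_const _ (by fun_prop), ← hab, ← add_mul, mul_comm, mul_assoc,
    ENNReal.mul_inv_cancel h0 ht, mul_one]

/-- Comparison of two laws carried by the same finite set of points. -/
theorem W1_le_sum_of_discrete {ι : Type*} (s : Finset ι) (y : ι → E d) (a b : ι → ℝ≥0∞)
    {μ ν : ProbabilityMeasure (E d)}
    (hμ : (μ : Measure (E d)) = ∑ c ∈ s, a c • Measure.dirac (y c))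
    (hν : (ν : Measure (E d)) = ∑ c ∈ s, b c • Measure.dirac (y c)) :
    W1 μ ν ≤ ∑ c ∈ s, ‖y c‖ₑ * ((a c - b c) + (b c - a c)) := by
  have hle : ∀ (w : ι → ℝ≥0∞) (ρ : ProbabilityMeasure (E d)),
      (ρ : Measure (E d)) = ∑ c ∈ s, w c • Measure.dirac (y c) → ∀ v : ι → ℝ≥0∞,
      IsFiniteMeasure (∑ c ∈ s, (w c - v c) • Measure.dirac (y c)) := by
    intro w ρ h v
    constructor
    have h1 := congrArg (fun τ : Measure (E d) => τ Set.univ) h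
    simp only [measure_univ, Measure.coe_finsetSum, Finset.sum_apply, Measure.smul_apply,
      smul_eq_mul, mul_one] at h1 ⊢
    exact (Finset.sum_le_sum fun c _ => tsub_le_self).trans_lt (h1 ▸ ENNReal.one_lt_top)
  have := hle a μ hμ b
  have := hle b ν hν a
  have key : ∀ (w v : ι → ℝ≥0∞), ∑ c ∈ s, w c • Measure.dirac (y c)
      = ∑ c ∈ s, min (w c) (v c) • Measure.dirac (y c)
        + ∑ c ∈ s, (w c - v c) • Measure.dirac (y c) := by
    intro w v
    rw [← Finset.sum_add_distrib]
    refine Finset.sum_congr rfl fun c _ => ?_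
    rw [← add_smul]
    congr 1
    rcases le_total (w c) (v c) with h | h
    · rw [min_eq_left h, tsub_eq_zero_of_le h, add_zero]
    · rw [min_eq_right h, add_tsub_cancel_of_le h]
  have hν' : (ν : Measure (E d)) = ∑ c ∈ s, min (a c) (b c) • Measure.dirac (y c)
      + ∑ c ∈ s, (b c - a c) • Measure.dirac (y c) := by
    rw [hν, key b a]
    congr 1
    exact Finset.sum_congr rfl fun c _ => by rw [min_comm]
  refine (W1_le_of_decomposition (hμ.trans (key a b)) hν').trans_eq ?_
  · simp only [lintegral_finsetSum_measure, lintegral_smul_measure, lintegral_dirac, smul_eq_mul,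
      ← Finset.sum_add_distrib, ← add_mul]
    exact Finset.sum_congr rfl fun c _ => mul_comm _ _

theorem W1_dirac_le (μ : ProbabilityMeasure (E d)) :
    W1 μ (diracProba 0) ≤ ∫⁻ x, ‖x‖ₑ ∂(μ : Measure (E d)) := by
  refine (W1_le_lintegral_edist (P := (μ : Measure (E d))) (g₁ := id) (g₂ := fun _ => 0)
    measurable_id measurable_const Measure.map_id ?_).trans (by simp)
  simp [diracProba]

theorem W1_ne_top {μ ν : ProbabilityMeasure (E d)} (hμ : FiniteFirstMoment μ)
    (hν : FiniteFirstMoment ν) : W1 μ ν ≠ ∞ := by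
  have h := W1_le_lintegral_edist (P := (μ : Measure (E d)).prod (ν : Measure (E d)))
    (g₁ := Prod.fst) (g₂ := Prod.snd) (μ := μ) (ν := ν) measurable_fst measurable_snd
    (by simp) (by simp)
  refine ne_top_of_le_ne_top ?_ h
  have h2 : ∫⁻ s, edist s.1 s.2 ∂((μ : Measure (E d)).prod (ν : Measure (E d))) ≤
      ∫⁻ s, (‖s.1‖ₑ + ‖s.2‖ₑ) ∂((μ : Measure (E d)).prod (ν : Measure (E d))) :=
    lintegral_mono fun s => by
      rw [edist_eq_enorm_sub]; exact enorm_sub_le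
  refine ne_top_of_le_ne_top ?_ h2
  rw [lintegral_add_left (by fun_prop), lintegral_prod _ (by fun_prop),
    lintegral_prod _ (by fun_prop)]
  simp only [lintegral_const, measure_univ, mul_one]
  exact (ENNReal.add_lt_top.2 ⟨hμ, hν⟩).ne

end Wasserstein

end WeakInteraction

/-! ### A moment inequality for sums of independent nonnegative variables -/

section MomentInequality

theorem ENNReal.add_rpow_le_two_rpow_mul {q : ℝ} (hq : 0 ≤ q) (a b : ℝ≥0∞) :
    (a + b) ^ q ≤ 2 ^ q * (a ^ q + b ^ q) := by
  have h : a + b ≤ 2 * max a b := by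
    rw [two_mul]; exact add_le_add (le_max_left _ _) (le_max_right _ _)
  refine (ENNReal.rpow_le_rpow h hq).trans ?_
  rw [ENNReal.mul_rpow_of_nonneg _ _ hq]
  gcongr
  rcases le_total a b with h | h
  · rw [max_eq_right h]; exact le_add_self
  · rw [max_eq_left h]; exact le_self_add

theorem lintegral_rpow_sub_one_le {Ω : Type*} [MeasurableSpace Ω] {P : Measure Ω}
    [IsProbabilityMeasure P] {S : Ω → ℝ≥0∞} (hS : Measurable S) {p : ℝ} (hp : 1 < p) :
    ∫⁻ w, S w ^ (p - 1) ∂P ≤ (∫⁻ w, S w ^ p ∂P) ^ ((p - 1) / p) := by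
  have hp0 : 0 < p := by linarith
  have hp1 : 0 < p - 1 := by linarith
  have hc : (p / (p - 1)).HolderConjugate p := (Real.HolderConjugate.conjExponent hp).symm
  have h := ENNReal.lintegral_mul_le_Lp_mul_Lq P hc (f := fun w => S w ^ (p - 1))
    (g := fun _ => 1) (hS.pow_const _).aemeasurable aemeasurable_const
  simp only [Pi.mul_apply, mul_one, ENNReal.one_rpow, lintegral_const, measure_univ,
    ← ENNReal.rpow_mul] at h
  rwa [show (p - 1) * (p / (p - 1)) = p by field_simp, one_div_div] at h

/-- Absorption: if `x` exceeded both `2a` and `(2b)^p`, each summand on the right of `h` would be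
less than `x / 2`. Finiteness of `x` is essential. -/
theorem ENNReal.le_of_le_add_mul_rpow {p : ℝ} (hp : 1 < p) {x a b : ℝ≥0∞} (hx : x ≠ ∞)
    (h : x ≤ a + b * x ^ ((p - 1) / p)) : x ≤ 2 * a + (2 * b) ^ p := by
  have hp0 : 0 < p := by linarith
  by_cases hab : 2 * a < x ∧ (2 * b) ^ p < x
  · exfalso
    obtain ⟨h1, h2⟩ := hab
    have hx0 : x ≠ 0 := (bot_le.trans_lt h1).ne'
    have h3 : 2 * b < x ^ (1 / p) := by
      rw [one_div, ENNReal.lt_rpow_inv_iff hp0]; exact h2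
    have hy : x ^ ((p - 1) / p) ≠ 0 := by simp [hx0, hx]
    have hy' : x ^ ((p - 1) / p) ≠ ∞ :=
      ENNReal.rpow_ne_top_of_nonneg (div_nonneg (by linarith) hp0.le) hx
    have h4 : 2 * b * x ^ ((p - 1) / p) < x := by
      calc 2 * b * x ^ ((p - 1) / p) < x ^ (1 / p) * x ^ ((p - 1) / p) :=
            (ENNReal.mul_lt_mul_iff_left hy hy').2 h3
        _ = x := by
            rw [← ENNReal.rpow_add _ _ hx0 hx, ← add_div, add_sub_cancel, div_self hp0.ne',
              ENNReal.rpow_one]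
    have h5 : 2 * a + 2 * b * x ^ ((p - 1) / p) < x + x := ENNReal.add_lt_add h1 h4
    rw [mul_assoc, ← mul_add, ← two_mul] at h5
    exact absurd h ((ENNReal.mul_lt_mul_iff_right (by simp) (by simp)).1 h5).not_ge
  · rw [not_and_or, not_lt, not_lt] at hab
    rcases hab with h | h
    · exact h.trans le_self_add
    · exact h.trans le_add_self

/-- Rosenthal's inequality for sums of independent nonnegative random variables. -/
theorem lintegral_sum_rpow_le_of_iIndepFun {ι Ω : Type*} [Fintype ι] [MeasurableSpace Ω]
    {P : Measure Ω} [IsProbabilityMeasure P] {Y : ι → Ω → ℝ≥0∞} (hm : ∀ i, Measurable (Y i))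
    (hind : iIndepFun Y P) {p : ℝ} (hp : 1 < p) :
    ∫⁻ w, (∑ i, Y i w) ^ p ∂P ≤ 2 * (2 ^ (p - 1) * ∑ i, ∫⁻ w, Y i w ^ p ∂P)
      + (2 * (2 ^ (p - 1) * ∑ i, ∫⁻ w, Y i w ∂P)) ^ p := by
  classical
  have hp0 : 0 < p := by linarith
  have hp1 : 0 < p - 1 := by linarith
  have hS : Measurable fun w => ∑ i, Y i w := Finset.measurable_fun_sum _ fun i _ => hm i
  -- The infinite case is trivial; otherwise the moment of the sum is finite, as absorption
  -- requires.
  by_cases hfin : ∑ i, ∫⁻ w, Y i w ^ p ∂P = ∞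
  · simp [hfin, ENNReal.mul_top]
  have hx : ∫⁻ w, (∑ i, Y i w) ^ p ∂P ≠ ∞ := by
    refine ne_top_of_le_ne_top ?_ (lintegral_mono fun w =>
      ENNReal.rpow_sum_le_const_mul_sum_rpow Finset.univ (fun i => Y i w) hp.le)
    rw [lintegral_const_mul _ (by fun_prop), lintegral_finsetSum _ (by fun_prop)]
    exact ENNReal.mul_ne_top (ENNReal.rpow_ne_top_of_nonneg hp1.le (by simp)) hfin
  refine ENNReal.le_of_le_add_mul_rpow hp hx ?_
  have hterm : ∀ i, ∫⁻ w, Y i w * (∑ j, Y j w) ^ (p - 1) ∂P ≤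
      2 ^ (p - 1) * (∫⁻ w, Y i w ^ p ∂P) + 2 ^ (p - 1) * (∫⁻ w, Y i w ∂P) *
        (∫⁻ w, (∑ i, Y i w) ^ p ∂P) ^ ((p - 1) / p) := by
    intro i
    -- Write `S^p = ∑ Yᵢ S^{p-1}` and split `S = Yᵢ + T` with `T` independent of `Yᵢ`. The mixed
    -- term factorizes, and its second factor is at most `E S^{p-1} ≤ (E S^p)^{(p-1)/p}`.
    let T : Ω → ℝ≥0∞ := fun w => ∑ j ∈ Finset.univ.erase i, Y j w
    have hT : Measurable T := Finset.measurable_fun_sum _ fun i _ => hm i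
    have hsum : ∀ w, ∑ j, Y j w = Y i w + T w := fun w =>
      (Finset.add_sum_erase _ _ (Finset.mem_univ i)).symm
    have hindep : IndepFun (Y i) (fun w => T w ^ (p - 1)) P := by
      have h := (hind.indepFun_finsetSum_of_notMem hm (s := Finset.univ.erase i) (i := i)
        (by simp)).symm
      have h' := h.comp (φ := id) (ψ := fun t : ℝ≥0∞ => t ^ (p - 1)) measurable_id
        (by fun_prop)
      have e : (fun w => T w ^ (p - 1)) =
          (fun t : ℝ≥0∞ => t ^ (p - 1)) ∘ ∑ j ∈ Finset.univ.erase i, Y j := by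
        funext w; simp [T]
      rw [e]; exact h'
    calc ∫⁻ w, Y i w * (∑ j, Y j w) ^ (p - 1) ∂P
        ≤ ∫⁻ w, (2 ^ (p - 1) * Y i w ^ p + 2 ^ (p - 1) * (Y i w * T w ^ (p - 1))) ∂P := by
          refine lintegral_mono fun w => ?_
          dsimp only
          rw [hsum w]
          refine (mul_le_mul_right (ENNReal.add_rpow_le_two_rpow_mul hp1.le _ _) _).trans_eq ?_
          have : Y i w ^ p = Y i w * Y i w ^ (p - 1) := by
            conv_rhs => rw [← ENNReal.rpow_one (Y i w), ← ENNReal.rpow_mul, one_mul]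
            rw [← ENNReal.rpow_add_of_nonneg _ _ zero_le_one hp1.le, add_sub_cancel]
          rw [this]; ring
      _ = 2 ^ (p - 1) * (∫⁻ w, Y i w ^ p ∂P) + 2 ^ (p - 1) * ((∫⁻ w, Y i w ∂P) *
            ∫⁻ w, T w ^ (p - 1) ∂P) := by
          rw [lintegral_add_left (by fun_prop), lintegral_const_mul _ (by fun_prop),
            lintegral_const_mul _ (by fun_prop)]
          congr 2
          exact lintegral_mul_eq_lintegral_mul_lintegral_of_indepFun (hm i) (by fun_prop) hindep
      _ ≤ _ := by
          rw [mul_assoc (2 ^ (p - 1))]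
          gcongr
          refine le_trans (lintegral_mono fun w => ?_) (lintegral_rpow_sub_one_le hS hp)
          refine ENNReal.rpow_le_rpow ?_ hp1.le
          rw [hsum w]; exact le_add_self
  calc ∫⁻ w, (∑ i, Y i w) ^ p ∂P
      = ∑ i, ∫⁻ w, Y i w * (∑ j, Y j w) ^ (p - 1) ∂P := by
        rw [← lintegral_finsetSum _ (by fun_prop)]
        refine lintegral_congr fun w => ?_
        rw [← Finset.sum_mul]
        conv_rhs => rw [← ENNReal.rpow_one (∑ j, Y j w), ← ENNReal.rpow_mul, one_mul]
        rw [← ENNReal.rpow_add_of_nonneg _ _ zero_le_one hp1.le, add_sub_cancel]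
    _ ≤ _ := Finset.sum_le_sum fun i _ => hterm i
    _ = _ := by rw [Finset.sum_add_distrib, Finset.mul_sum, Finset.mul_sum, Finset.sum_mul]

end MomentInequality

/-! ### Sub-Gaussian control of cell frequencies -/

section Discrepancy

theorem cellSign_eq_sum {S κ : Type*} [DecidableEq κ] {q : S → κ} {A B : Finset κ} {s : S}
    (hs : q s ∈ B) :
    (if q s ∈ A then (1 : ℝ) else -1) =
      ∑ c ∈ B, (if c ∈ A then 1 else -1) * (if q s = c then 1 else 0) := by
  simp [hs]

variable {N : ℕ} {S κ : Type*} [MeasurableSpace S] [MeasurableSpace κ]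
  [MeasurableSingletonClass κ] [DecidableEq κ]

/-- The real-valued `ℓ¹` discrepancy between the empirical and the mean frequencies of the
cells `{q = c}`, `c ∈ B`. -/
noncomputable def cellDiscrepancy (q : S → κ) (B : Finset κ) (ν : Fin N → Measure S)
    (y : Fin N → S) : ℝ :=
  ∑ c ∈ B, |(N : ℝ)⁻¹ * ∑ i, ((if q (y i) = c then 1 else 0) - (ν i).real (q ⁻¹' {c}))|

/-- The sign function of a set of cells. -/
noncomputable def cellSign (q : S → κ) (A : Finset κ) (s : S) : ℝ := if q s ∈ A then 1 else -1

theorem measurable_cellSign {q : S → κ} (hq : Measurable q) (A : Finset κ) :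
    Measurable (cellSign q A) :=
  Measurable.ite (hq A.measurableSet) measurable_const measurable_const

theorem integral_cellSign {q : S → κ} (hq : Measurable q) {A B : Finset κ} (hB : ∀ s, q s ∈ B)
    (ν : Measure S) [IsProbabilityMeasure ν] :
    ∫ s, cellSign q A s ∂ν = ∑ c ∈ B, (if c ∈ A then 1 else -1) * ν.real (q ⁻¹' {c}) := by
  simp_rw [cellSign, cellSign_eq_sum (hB _)]
  have e : ∀ c, (fun s => if q s = c then (1 : ℝ) else 0) = (q ⁻¹' {c}).indicator 1 := by
    intro c; funext s; by_cases h : q s = c <;> simp [h]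
  have hm : ∀ c, MeasurableSet (q ⁻¹' {c}) := fun c => hq (measurableSet_singleton c)
  rw [integral_finsetSum]
  · refine Finset.sum_congr rfl fun c _ => ?_
    rw [integral_const_mul, e, integral_indicator_one (hm c)]
  · intro c _
    have h := ((integrable_const (μ := ν) (1 : ℝ)).indicator (hm c)).const_mul
      (if c ∈ A then 1 else -1)
    change Integrable (fun s => _ * (q ⁻¹' {c}).indicator 1 s) ν at h
    rwa [← e] at h

/-- An `ℓ¹` norm is attained by pairing with a sign vector: `A` collects the cells whose deviation
is nonnegative. Only `2 ^ B.card` linear statistics then have to be controlled. -/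
theorem exists_cellDiscrepancy_eq {q : S → κ} (hq : Measurable q) {B : Finset κ}
    (hB : ∀ s, q s ∈ B) (ν : Fin N → Measure S) [∀ i, IsProbabilityMeasure (ν i)]
    (y : Fin N → S) : ∃ A ∈ B.powerset, cellDiscrepancy q B ν y =
      (N : ℝ)⁻¹ * ∑ i, (cellSign q A (y i) - ∫ s, cellSign q A s ∂ν i) := by
  let Δ : κ → ℝ := fun c => (N : ℝ)⁻¹ *
    ∑ i, ((if q (y i) = c then 1 else 0) - (ν i).real (q ⁻¹' {c}))
  refine ⟨B.filter fun c => 0 ≤ Δ c, by simp, ?_⟩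
  simp_rw [integral_cellSign hq hB, cellSign, cellSign_eq_sum (hB _), ← Finset.sum_sub_distrib, ← mul_sub]
  rw [Finset.sum_comm, Finset.mul_sum]
  refine Finset.sum_congr rfl fun c hc => ?_
  rw [← Finset.mul_sum, mul_left_comm]
  change |Δ c| = _ * Δ c
  by_cases h : 0 ≤ Δ c
  · simp [hc, h, abs_of_nonneg]
  · simp [h, abs_of_neg (not_le.1 h)]

/-- Hoeffding's lemma: values in `[-1, 1]` give variance proxy one per coordinate, and the proxies
add by independence. The coordinates may have different laws. -/
theorem lintegral_exp_cellSign_le {q : S → κ} (hq : Measurable q) (A : Finset κ)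
    (ν : Fin N → Measure S) [∀ i, IsProbabilityMeasure (ν i)] (t : ℝ) :
    ∫⁻ y, ENNReal.ofReal (Real.exp (t * ∑ i, (cellSign q A (y i) - ∫ s, cellSign q A s ∂ν i)))
      ∂(Measure.pi ν) ≤ ENNReal.ofReal (Real.exp (N * t ^ 2 / 2)) := by
  have hsub : ∀ i, HasSubgaussianMGF
      (fun y : Fin N → S => cellSign q A (y i) - ∫ s, cellSign q A s ∂ν i) 1 (Measure.pi ν) := by
    intro i
    have h := hasSubgaussianMGF_of_mem_Icc (μ := Measure.pi ν) (a := -1) (b := 1)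
      (X := fun y : Fin N → S => cellSign q A (y i))
      ((measurable_cellSign hq A).comp (measurable_pi_apply i)).aemeasurable
      (ae_of_all _ fun y => by unfold cellSign; split_ifs <;> simp)
    have e : ∫ y, cellSign q A (y i) ∂(Measure.pi ν) = ∫ s, cellSign q A s ∂ν i := by
      rw [← (measurePreserving_eval ν i).map_eq,
        integral_map (measurable_pi_apply i).aemeasurable
          (measurable_cellSign hq A).aestronglyMeasurable]
    rw [e] at h
    convert h using 1
    norm_num
  have hind : iIndepFun (fun (i : Fin N) (y : Fin N → S) =>
      cellSign q A (y i) - ∫ s, cellSign q A s ∂ν i) (Measure.pi ν) :=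
    iIndepFun_pi (X := fun i s => cellSign q A s - ∫ s, cellSign q A s ∂ν i)
      fun i => ((measurable_cellSign hq A).sub_const _).aemeasurable
  have h := HasSubgaussianMGF.sum_of_iIndepFun hind (s := Finset.univ) fun i _ => hsub i
  rw [← ofReal_integral_eq_lintegral_ofReal (h.integrable_exp_mul t)
    (ae_of_all _ fun _ => (Real.exp_pos _).le)]
  refine ENNReal.ofReal_le_ofReal ((h.mgf_le t).trans_eq ?_)
  simp

theorem measurable_cellDiscrepancy {q : S → κ} (hq : Measurable q) (B : Finset κ)
    (ν : Fin N → Measure S) : Measurable (cellDiscrepancy q B ν) := by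
  unfold cellDiscrepancy
  refine Finset.measurable_fun_sum _ fun c _ => ?_
  suffices h : Measurable fun y : Fin N → S => (N : ℝ)⁻¹ *
      ∑ i, ((if q (y i) = c then 1 else 0) - (ν i).real (q ⁻¹' {c})) from
    continuous_abs.measurable.comp h
  refine Measurable.const_mul ?_ _
  refine Finset.measurable_fun_sum _ fun i _ => Measurable.sub_const ?_ _
  exact Measurable.ite ((hq.comp (measurable_pi_apply i)) (measurableSet_singleton c))
    measurable_const measurable_const

theorem lintegral_exp_cellDiscrepancy_le [NeZero N] {q : S → κ} (hq : Measurable q) {B : Finset κ}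
    (hB : ∀ s, q s ∈ B) (ν : Fin N → Measure S) [∀ i, IsProbabilityMeasure (ν i)] (t : ℝ) :
    ∫⁻ y, ENNReal.ofReal (Real.exp (t * N * cellDiscrepancy q B ν y)) ∂(Measure.pi ν)
      ≤ ENNReal.ofReal (2 ^ B.card * Real.exp (N * t ^ 2 / 2)) := by
  have hN : (N : ℝ) ≠ 0 := by exact_mod_cast NeZero.ne N
  calc ∫⁻ y, ENNReal.ofReal (Real.exp (t * N * cellDiscrepancy q B ν y)) ∂(Measure.pi ν)
      ≤ ∫⁻ y, ∑ A ∈ B.powerset, ENNReal.ofReal (Real.exp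
          (t * ∑ i, (cellSign q A (y i) - ∫ s, cellSign q A s ∂ν i))) ∂(Measure.pi ν) := by
        refine lintegral_mono fun y => ?_
        obtain ⟨A, hA, h⟩ := exists_cellDiscrepancy_eq hq hB ν y
        dsimp only
        rw [h, mul_assoc, mul_inv_cancel_left₀ hN]
        exact Finset.single_le_sum (f := fun A => ENNReal.ofReal (Real.exp
          (t * ∑ i, (cellSign q A (y i) - ∫ s, cellSign q A s ∂ν i)))) (fun _ _ => zero_le) hA
    _ = ∑ A ∈ B.powerset, ∫⁻ y, ENNReal.ofReal (Real.exp
          (t * ∑ i, (cellSign q A (y i) - ∫ s, cellSign q A s ∂ν i))) ∂(Measure.pi ν) := by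
        refine lintegral_finsetSum _ fun A _ => ?_
        have := measurable_cellSign hq A
        fun_prop
    _ ≤ ∑ A ∈ B.powerset, ENNReal.ofReal (Real.exp (N * t ^ 2 / 2)) :=
        Finset.sum_le_sum fun A _ => lintegral_exp_cellSign_le hq A ν t
    _ = _ := by
        rw [Finset.sum_const, Finset.card_powerset, nsmul_eq_mul,
          ENNReal.ofReal_mul (by positivity), ENNReal.ofReal_pow (by norm_num)]
        simp

theorem rpow_le_rpow_mul_exp {p x : ℝ} (hp : 0 < p) (hx : 0 ≤ x) :
    x ^ p ≤ p ^ p * Real.exp x := by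
  have h : x ≤ p * Real.exp (x / p) := by
    have := Real.add_one_le_exp (x / p)
    calc x = p * (x / p) := by field_simp
      _ ≤ _ := by gcongr; linarith
  calc x ^ p ≤ (p * Real.exp (x / p)) ^ p := Real.rpow_le_rpow hx h hp.le
    _ = p ^ p * Real.exp x := by
      rw [Real.mul_rpow hp.le (Real.exp_pos _).le, ← Real.exp_mul, div_mul_cancel₀ _ hp.ne']

/-- A power is traded for an exponential of rate `K`. The shift `-2K` is there to beat the factor
`2^K e^{K/2}` that comes with an exponential moment over `K` cells. -/
theorem rpow_le_add_mul_exp {p u K : ℝ} (hp : 0 < p) (hu : 0 ≤ u) (hK : 1 ≤ K) :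
    u ^ p ≤ 2 ^ p * (2 ^ p + p ^ p * Real.exp (K * u - 2 * K)) := by
  have h2 : (1 : ℝ) ≤ 2 ^ p := Real.one_le_rpow (by norm_num) hp.le
  have hpp : 0 < p ^ p := Real.rpow_pos_of_pos hp p
  by_cases h : u ≤ 2
  · have h3 : u ^ p ≤ 2 ^ p := Real.rpow_le_rpow hu h hp.le
    have h4 : 0 ≤ p ^ p * Real.exp (K * u - 2 * K) := by positivity
    nlinarith
  · push Not at h
    have h1 : u ≤ 2 * max 2 (u - 2) := by
      have := le_max_left 2 (u - 2); have := le_max_right 2 (u - 2); linarith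
    have h3 : (max 2 (u - 2)) ^ p ≤ 2 ^ p + (u - 2) ^ p := by
      rcases le_total 2 (u - 2) with h' | h'
      · rw [max_eq_right h']; linarith
      · rw [max_eq_left h']
        have : 0 ≤ (u - 2) ^ p := Real.rpow_nonneg (by linarith) _
        linarith
    have h5 : (u - 2) ^ p ≤ p ^ p * Real.exp (K * u - 2 * K) := by
      refine (rpow_le_rpow_mul_exp hp (by linarith)).trans ?_
      refine mul_le_mul_of_nonneg_left (Real.exp_le_exp.2 ?_) hpp.le
      nlinarith
    calc u ^ p ≤ (2 * max 2 (u - 2)) ^ p := Real.rpow_le_rpow hu h1 hp.le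
      _ = 2 ^ p * (max 2 (u - 2)) ^ p :=
          Real.mul_rpow (by norm_num) (le_trans (by norm_num) (le_max_left _ _))
      _ ≤ _ := by gcongr; linarith

/-- The moments of the discrepancy over `K` cells are of order `(K / N) ^ (p / 2)`. -/
theorem lintegral_cellDiscrepancy_rpow_le [NeZero N] {q : S → κ} (hq : Measurable q)
    {B : Finset κ} (hB : ∀ s, q s ∈ B) (hcard : 1 ≤ B.card) (ν : Fin N → Measure S)
    [∀ i, IsProbabilityMeasure (ν i)] {p : ℝ} (hp : 0 < p) :
    ∫⁻ y, ENNReal.ofReal (cellDiscrepancy q B ν y) ^ p ∂(Measure.pi ν)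
      ≤ ENNReal.ofReal (2 ^ p * (2 ^ p + p ^ p) * Real.sqrt (B.card / N) ^ p) := by
  set K : ℝ := (B.card : ℝ) with hKdef
  have hK : 1 ≤ K := by rw [hKdef]; exact_mod_cast hcard
  have hK0 : 0 < K := by linarith
  have hN : 0 < (N : ℝ) := by exact_mod_cast Nat.pos_of_ne_zero (NeZero.ne N)
  -- The expected size of the discrepancy, used also as the tilt: with `t = r`, the exponent `tN ·
  -- disc` is `K · (disc / r)` and the Hoeffding term `N r² / 2` is `K / 2`.
  set r := Real.sqrt (K / N) with hr
  have hr0 : 0 < r := Real.sqrt_pos.2 (by positivity)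
  have hr2 : r ^ 2 = K / N := Real.sq_sqrt (by positivity)
  have hnn : ∀ y, 0 ≤ cellDiscrepancy q B ν y := fun y =>
    Finset.sum_nonneg fun _ _ => abs_nonneg _
  have hpp : 0 < p ^ p := Real.rpow_pos_of_pos hp p
  have hpt : ∀ y, cellDiscrepancy q B ν y ^ p ≤ r ^ p * 2 ^ p * 2 ^ p + r ^ p * 2 ^ p * p ^ p *
      Real.exp (-(2 * K)) * Real.exp (r * N * cellDiscrepancy q B ν y) := by
    intro y
    have h := rpow_le_add_mul_exp hp (div_nonneg (hnn y) hr0.le) hK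
    have e : K * (cellDiscrepancy q B ν y / r) = r * N * cellDiscrepancy q B ν y := by
      have : K = r ^ 2 * N := by rw [hr2]; field_simp
      rw [this]; field_simp
    rw [e, Real.div_rpow (hnn y) hr0.le, div_le_iff₀ (Real.rpow_pos_of_pos hr0 p),
      sub_eq_neg_add, Real.exp_add] at h
    linarith
  calc ∫⁻ y, ENNReal.ofReal (cellDiscrepancy q B ν y) ^ p ∂(Measure.pi ν)
      ≤ ∫⁻ y, (ENNReal.ofReal (r ^ p * 2 ^ p * 2 ^ p) + ENNReal.ofReal (r ^ p * 2 ^ p * p ^ p *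
          Real.exp (-(2 * K))) * ENNReal.ofReal (Real.exp (r * N * cellDiscrepancy q B ν y)))
          ∂(Measure.pi ν) := by
        refine lintegral_mono fun y => ?_
        dsimp only
        rw [ENNReal.ofReal_rpow_of_nonneg (hnn y) hp.le, ← ENNReal.ofReal_mul (by positivity),
          ← ENNReal.ofReal_add (by positivity) (by positivity)]
        exact ENNReal.ofReal_le_ofReal (hpt y)
    _ ≤ ENNReal.ofReal (r ^ p * 2 ^ p * 2 ^ p) + ENNReal.ofReal (r ^ p * 2 ^ p * p ^ p *
          Real.exp (-(2 * K))) * ENNReal.ofReal (2 ^ B.card * Real.exp (N * r ^ 2 / 2)) := by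
        have := measurable_cellDiscrepancy hq B ν
        rw [lintegral_add_left (by fun_prop), lintegral_const_mul _ (by fun_prop)]
        simp only [lintegral_const, measure_univ, mul_one]
        gcongr
        exact lintegral_exp_cellDiscrepancy_le hq hB ν r
    _ ≤ _ := by
        rw [← ENNReal.ofReal_mul (by positivity), ← ENNReal.ofReal_add (by positivity)
          (by positivity)]
        refine ENNReal.ofReal_le_ofReal ?_
        have h2 : (2 : ℝ) ^ B.card ≤ Real.exp K := by
          rw [hKdef, ← mul_one (B.card : ℝ), Real.exp_nat_mul]
          gcongr
          have := Real.add_one_le_exp (1 : ℝ); linarith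
        have e : N * r ^ 2 / 2 = K / 2 := by rw [hr2]; field_simp
        have h3 : Real.exp (-(2 * K)) * (2 ^ B.card * Real.exp (N * r ^ 2 / 2)) ≤ 1 := by
          calc _ ≤ Real.exp (-(2 * K)) * (Real.exp K * Real.exp (K / 2)) := by rw [e]; gcongr
            _ = Real.exp (-(2 * K) + (K + K / 2)) := by rw [Real.exp_add, Real.exp_add]
            _ ≤ 1 := Real.exp_le_one_iff.2 (by linarith)
        have h4 : 0 ≤ r ^ p * 2 ^ p * p ^ p := by positivity
        have := mul_le_mul_of_nonneg_left h3 h4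
        linarith

end Discrepancy

namespace WeakInteraction

/-! ### Truncation and rounding to a grid -/

section Quantization

variable {d : ℕ}

/-- The index of the cell of side `h` that contains `v`, for `v` in the ball of radius `R`;
points outside the ball are sent to the cell at the origin. -/
noncomputable def cellIndex (R h : ℝ) (v : E d) : Fin d → ℤ :=
  if ‖v‖ ≤ R then fun k => ⌊v k / h⌋ else 0

/-- The corner of the cell with index `c`. -/
noncomputable def cellPoint (h : ℝ) (c : Fin d → ℤ) : E d := WithLp.toLp 2 fun k => h * c k

/-- The norm, cut to `0` on the ball of radius `R`. -/
noncomputable def tailNorm (R : ℝ) (v : E d) : ℝ≥0∞ := if ‖v‖ ≤ R then 0 else ‖v‖ₑ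

/-- The box of all indices with coordinates in `[-L, L]`. -/
noncomputable def cellBox (d L : ℕ) : Finset (Fin d → ℤ) := Fintype.piFinset fun _ => Finset.Icc (-(L : ℤ)) L

theorem card_cellBox (d L : ℕ) : (cellBox d L).card = (2 * L + 1) ^ d := by
  simp only [cellBox, Fintype.card_piFinset, Int.card_Icc, Finset.prod_const, Finset.card_univ,
    Fintype.card_fin]
  congr 1
  omega

theorem norm_le_mul_of_forall_abs_le {x : E d} {a : ℝ} (ha : 0 ≤ a) (hx : ∀ k, |x k| ≤ a) :
    ‖x‖ ≤ d * a := by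
  rw [EuclideanSpace.norm_eq]
  refine Real.sqrt_le_iff.2 ⟨by positivity, ?_⟩
  calc ∑ k, ‖x k‖ ^ 2 ≤ ∑ _k : Fin d, a ^ 2 :=
        Finset.sum_le_sum fun k _ => pow_le_pow_left₀ (norm_nonneg _) (hx k) 2
    _ = d * a ^ 2 := by simp
    _ ≤ (d * a) ^ 2 := by
        rcases Nat.eq_zero_or_pos d with h | h
        · simp [h]
        · have : (1 : ℝ) ≤ d := by exact_mod_cast h
          rw [mul_pow]
          gcongr
          nlinarith

theorem measurable_cellIndex (R h : ℝ) : Measurable (cellIndex (d := d) R h) := by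
  refine Measurable.ite (measurableSet_le (by fun_prop) (by fun_prop)) ?_ measurable_const
  refine measurable_pi_lambda _ fun k => Int.measurable_floor.comp ?_
  fun_prop

theorem measurable_tailNorm (R : ℝ) : Measurable (tailNorm (d := d) R) :=
  Measurable.ite (measurableSet_le (by fun_prop) (by fun_prop)) measurable_const (by fun_prop)

theorem cellIndex_mem_cellBox {R h : ℝ} {L : ℕ} (hh : 0 < h) (hL : R ≤ L * h) (v : E d) :
    cellIndex R h v ∈ cellBox d L := by
  unfold cellIndex cellBox
  rw [Fintype.mem_piFinset]
  intro k
  split_ifs with hv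
  · have h1 : |v k| ≤ R := (PiLp.norm_apply_le v k).trans hv
    rw [abs_le] at h1
    rw [Finset.mem_Icc]
    constructor
    · rw [Int.le_floor, le_div_iff₀ hh]; push_cast; linarith
    · have : v k / h ≤ (L : ℤ) := by rw [div_le_iff₀ hh]; push_cast; linarith
      change ⌊v k / h⌋ ≤ (L : ℤ)
      exact Int.cast_le.1 ((Int.floor_le _).trans this)
  · simp

theorem norm_cellPoint_le {h : ℝ} {L : ℕ} (hh : 0 < h) {c : Fin d → ℤ} (hc : c ∈ cellBox d L) :
    ‖cellPoint h c‖ ≤ d * (L * h) := by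
  refine norm_le_mul_of_forall_abs_le (by positivity) fun k => ?_
  have h1 := Fintype.mem_piFinset.1 hc k
  rw [Finset.mem_Icc, ← abs_le] at h1
  have h2 : |(c k : ℝ)| ≤ L := by exact_mod_cast h1
  change |h * c k| ≤ _
  rw [abs_mul, abs_of_pos hh, mul_comm]
  gcongr

theorem edist_cellPoint_le {R h : ℝ} (hh : 0 < h) (v : E d) :
    edist v (cellPoint h (cellIndex R h v)) ≤ ENNReal.ofReal (d * h) + tailNorm R v := by
  unfold tailNorm cellIndex
  split_ifs with hv
  · rw [add_zero, edist_dist, dist_eq_norm]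
    refine ENNReal.ofReal_le_ofReal (norm_le_mul_of_forall_abs_le hh.le fun k => ?_)
    change |v k - h * ⌊v k / h⌋| ≤ h
    have h1 := Int.floor_le (v k / h)
    have h2 := (Int.lt_floor_add_one (v k / h)).le
    rw [le_div_iff₀ hh] at h1
    rw [div_le_iff₀ hh] at h2
    rw [abs_le]
    constructor <;> linarith
  · have : cellPoint h (0 : Fin d → ℤ) = 0 := by ext k; simp [cellPoint]
    rw [this, edist_zero_right]
    exact le_add_self

theorem tailNorm_le {R p : ℝ} (hR : 0 < R) (hp : 1 ≤ p) (v : E d) :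
    tailNorm R v ≤ ENNReal.ofReal R ^ (1 - p) * ‖v‖ₑ ^ p := by
  unfold tailNorm
  split_ifs with hv
  · exact zero_le
  · push Not at hv
    have h0 : ENNReal.ofReal R ≠ 0 := by simpa using hR
    have h1 : ENNReal.ofReal R ^ (p - 1) ≤ ‖v‖ₑ ^ (p - 1) := by
      refine ENNReal.rpow_le_rpow ?_ (by linarith)
      rw [← ofReal_norm]
      exact ENNReal.ofReal_le_ofReal hv.le
    calc ‖v‖ₑ = ENNReal.ofReal R ^ (1 - p) * (ENNReal.ofReal R ^ (p - 1) * ‖v‖ₑ) := by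
          rw [← mul_assoc, ← ENNReal.rpow_add _ _ h0 (by simp)]; simp
      _ ≤ ENNReal.ofReal R ^ (1 - p) * (‖v‖ₑ ^ (p - 1) * ‖v‖ₑ ^ (1 : ℝ)) := by
          rw [ENNReal.rpow_one]; gcongr
      _ = _ := by
          rw [← ENNReal.rpow_add_of_nonneg _ _ (by linarith) zero_le_one]; simp

/-- The box contains every index that occurs, including that of the points beyond `R`, so all
rounded laws live on one finite set and only their weights need comparing. -/
theorem map_cellPoint_cellIndex {R h : ℝ} {L : ℕ} (hh : 0 < h) (hL : R ≤ L * h)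
    (μ : Measure (E d)) :
    μ.map (fun v => cellPoint h (cellIndex R h v)) =
      ∑ c ∈ cellBox d L, μ (cellIndex R h ⁻¹' {c}) • Measure.dirac (cellPoint h c) := by
  classical
  have hT : Measurable fun v : E d => cellPoint h (cellIndex R h v) :=
    (measurable_of_countable (cellPoint h)).comp (measurable_cellIndex R h)
  ext s hs
  rw [← lintegral_indicator_one hs, ← lintegral_indicator_one hs,
    lintegral_map (measurable_one.indicator hs) hT]
  simp only [lintegral_finsetSum_measure, lintegral_smul_measure, lintegral_dirac, smul_eq_mul]
  have e : ∀ v : E d, s.indicator (1 : E d → ℝ≥0∞) (cellPoint h (cellIndex R h v)) =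
      ∑ c ∈ cellBox d L, (cellIndex R h ⁻¹' {c}).indicator
        (fun _ => s.indicator (1 : E d → ℝ≥0∞) (cellPoint h c)) v := by
    intro v
    rw [Finset.sum_eq_single (cellIndex R h v)]
    · simp
    · intro c _ hc
      rw [Set.indicator_of_notMem]
      simpa using hc.symm
    · exact fun h' => absurd (cellIndex_mem_cellBox hh hL v) h'
  have hm : ∀ c, MeasurableSet (cellIndex (d := d) R h ⁻¹' {c}) := fun c =>
    measurable_cellIndex R h (measurableSet_singleton c)
  simp_rw [e]
  rw [lintegral_finsetSum _ fun c _ => measurable_const.indicator (hm c)]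
  refine Finset.sum_congr rfl fun c _ => ?_
  rw [lintegral_indicator_const (hm c), mul_comm]

end Quantization

/-! ### Empirical measures of independent variables with different laws -/

section Gap

variable {d N : ℕ}

/-- The empirical frequency of the cell `c`. -/
noncomputable def empFreq (R h : ℝ) (y : Fin N → E d) (c : Fin d → ℤ) : ℝ≥0∞ :=
  (N : ℝ≥0∞)⁻¹ * ∑ i, if cellIndex R h (y i) = c then 1 else 0

/-- The mean frequency of the cell `c`. -/
noncomputable def meanFreq (R h : ℝ) (ν : Fin N → Measure (E d)) (c : Fin d → ℤ) : ℝ≥0∞ :=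
  (N : ℝ≥0∞)⁻¹ * ∑ i, ν i (cellIndex R h ⁻¹' {c})

/-- An explicit upper bound, measurable in all its arguments, for the Wasserstein distance
between the empirical measure of `y` and the average of the laws `ν`. -/
noncomputable def gap (R h : ℝ) (L : ℕ) (y : Fin N → E d) (ν : Fin N → Measure (E d)) : ℝ≥0∞ :=
  ENNReal.ofReal (2 * (d * h)) + (∑ i, (N : ℝ≥0∞)⁻¹ * tailNorm R (y i))
    + (∑ i, (N : ℝ≥0∞)⁻¹ * ∫⁻ v, tailNorm R v ∂ν i)
    + ENNReal.ofReal (d * (L * h)) * ∑ c ∈ cellBox d L,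
      ((empFreq R h y c - meanFreq R h ν c) + (meanFreq R h ν c - empFreq R h y c))

theorem measurable_gap (R h : ℝ) (L : ℕ) :
    Measurable fun p : (Fin N → E d) × (Fin N → Measure (E d)) => gap R h L p.1 p.2 := by
  have hm : ∀ c, MeasurableSet (cellIndex (d := d) R h ⁻¹' {c}) := fun c =>
    measurable_cellIndex R h (measurableSet_singleton c)
  have h1 : ∀ c, Measurable fun p : (Fin N → E d) × (Fin N → Measure (E d)) =>
      empFreq R h p.1 c := by
    intro c
    refine Measurable.const_mul (Finset.measurable_fun_sum _ fun i _ => ?_) _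
    refine Measurable.ite ?_ measurable_const measurable_const
    exact ((measurable_cellIndex R h).comp ((measurable_pi_apply i).comp measurable_fst))
      (measurableSet_singleton c)
  have h2 : ∀ c, Measurable fun p : (Fin N → E d) × (Fin N → Measure (E d)) =>
      meanFreq R h p.2 c := by
    intro c
    refine Measurable.const_mul (Finset.measurable_fun_sum _ fun i _ => ?_) _
    exact (Measure.measurable_coe (hm c)).comp ((measurable_pi_apply i).comp measurable_snd)
  have h3 : ∀ i, Measurable fun p : (Fin N → E d) × (Fin N → Measure (E d)) =>
      tailNorm R (p.1 i) := fun i =>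
    (measurable_tailNorm R).comp ((measurable_pi_apply i).comp measurable_fst)
  have h4 : ∀ i, Measurable fun p : (Fin N → E d) × (Fin N → Measure (E d)) =>
      ∫⁻ v, tailNorm R v ∂(p.2 i) := fun i =>
    (Measure.measurable_lintegral (measurable_tailNorm R)).comp
      ((measurable_pi_apply i).comp measurable_snd)
  unfold gap
  fun_prop

theorem measurable_gap_comp {S : Type*} [MeasurableSpace S] (R h : ℝ) (L : ℕ)
    {y : S → Fin N → E d} {ν : S → Fin N → Measure (E d)} (hy : Measurable y) (hν : Measurable ν) :
    Measurable fun s => gap R h L (y s) (ν s) := by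
  have h₁ : Measurable fun s => (y s, ν s) := hy.prodMk hν
  have h₂ := (measurable_gap (d := d) (N := N) R h L).comp h₁
  exact h₂

theorem coe_empirical [NeZero N] (x : Fin N → E d) :
    (empirical x : Measure (E d)) = (N : ℝ≥0∞)⁻¹ • ∑ i, Measure.dirac (x i) := rfl

theorem lintegral_empirical [NeZero N] (x : Fin N → E d) (g : E d → ℝ≥0∞) :
    ∫⁻ v, g v ∂(empirical x : Measure (E d)) = ∑ i, (N : ℝ≥0∞)⁻¹ * g (x i) := by
  rw [coe_empirical, lintegral_smul_measure, lintegral_finsetSum_measure, smul_eq_mul,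
    Finset.mul_sum]
  simp

theorem W1_cellPoint_le {R h : ℝ} (hh : 0 < h) {ρ ρ' : ProbabilityMeasure (E d)}
    (hρ : (ρ : Measure (E d)).map (fun v => cellPoint h (cellIndex R h v)) = ρ') :
    W1 ρ ρ' ≤ ENNReal.ofReal (d * h) + ∫⁻ v, tailNorm R v ∂(ρ : Measure (E d)) ∧
    W1 ρ' ρ ≤ ENNReal.ofReal (d * h) + ∫⁻ v, tailNorm R v ∂(ρ : Measure (E d)) := by
  have hT : Measurable fun v : E d => cellPoint h (cellIndex R h v) :=
    (measurable_of_countable (cellPoint h)).comp (measurable_cellIndex R h)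
  have key : ∫⁻ v, edist v (cellPoint h (cellIndex R h v)) ∂(ρ : Measure (E d)) ≤
      ENNReal.ofReal (d * h) + ∫⁻ v, tailNorm R v ∂(ρ : Measure (E d)) := by
    refine (lintegral_mono fun v => edist_cellPoint_le hh v).trans_eq ?_
    rw [lintegral_add_left measurable_const]; simp
  constructor
  · exact (W1_le_lintegral_edist measurable_id hT Measure.map_id hρ).trans key
  · refine (W1_le_lintegral_edist hT measurable_id hρ Measure.map_id).trans ?_
    simp_rw [edist_comm _ (id _)]
    exact key

/-- The path goes through the two rounded measures. Each rounding costs `d * h` plus a tail; between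
them, mass that changes cell costs at most the norms of the grid points. -/
theorem W1_empirical_le_gap [NeZero N] {R h : ℝ} {L : ℕ} (hh : 0 < h) (hL : R ≤ L * h)
    (y : Fin N → E d) (ν : Fin N → Measure (E d)) (ρ : ProbabilityMeasure (E d))
    (hρ : (ρ : Measure (E d)) = (N : ℝ≥0∞)⁻¹ • ∑ i, ν i) :
    W1 (empirical y) ρ ≤ gap R h L y ν := by
  have hT : Measurable fun v : E d => cellPoint h (cellIndex R h v) :=
    (measurable_of_countable (cellPoint h)).comp (measurable_cellIndex R h)
  have hm : ∀ c, MeasurableSet (cellIndex (d := d) R h ⁻¹' {c}) := fun c =>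
    measurable_cellIndex R h (measurableSet_singleton c)
  let μ₁ := (empirical y).map hT.aemeasurable
  let μ₂ := ρ.map hT.aemeasurable
  have e₁ : (μ₁ : Measure (E d)) =
      ∑ c ∈ cellBox d L, empFreq R h y c • Measure.dirac (cellPoint h c) := by
    change (empirical y : Measure (E d)).map _ = _
    rw [map_cellPoint_cellIndex hh hL]
    refine Finset.sum_congr rfl fun c _ => ?_
    congr 1
    rw [coe_empirical, empFreq, Measure.smul_apply, Measure.coe_finsetSum, Finset.sum_apply,
      smul_eq_mul]
    congr 1
    refine Finset.sum_congr rfl fun i _ => ?_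
    rw [Measure.dirac_apply' _ (hm c)]
    by_cases h' : cellIndex R h (y i) = c <;> simp [h']
  have e₂ : (μ₂ : Measure (E d)) =
      ∑ c ∈ cellBox d L, meanFreq R h ν c • Measure.dirac (cellPoint h c) := by
    change (ρ : Measure (E d)).map _ = _
    rw [map_cellPoint_cellIndex hh hL]
    refine Finset.sum_congr rfl fun c _ => ?_
    congr 1
    simp [hρ, meanFreq]
  have w₁ := (W1_cellPoint_le (R := R) hh (ρ := empirical y) (ρ' := μ₁) rfl).1
  have w₂ := (W1_cellPoint_le (R := R) hh (ρ := ρ) (ρ' := μ₂) rfl).2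
  have w₃ := W1_le_sum_of_discrete (cellBox d L) _ _ _ e₁ e₂
  rw [lintegral_empirical] at w₁
  have e₃ : ∫⁻ v, tailNorm R v ∂(ρ : Measure (E d)) =
      ∑ i, (N : ℝ≥0∞)⁻¹ * ∫⁻ v, tailNorm R v ∂ν i := by
    rw [hρ, lintegral_smul_measure, lintegral_finsetSum_measure, smul_eq_mul, Finset.mul_sum]
  rw [e₃] at w₂
  have w₄ : W1 μ₁ μ₂ ≤ ENNReal.ofReal (d * (L * h)) * ∑ c ∈ cellBox d L,
      ((empFreq R h y c - meanFreq R h ν c) + (meanFreq R h ν c - empFreq R h y c)) := by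
    refine w₃.trans ?_
    rw [Finset.mul_sum]
    refine Finset.sum_le_sum fun c hc => mul_le_mul_left ?_ _
    rw [← ofReal_norm]
    exact ENNReal.ofReal_le_ofReal (norm_cellPoint_le hh hc)
  refine (W1_triangle _ μ₁ _).trans ((add_le_add w₁ ((W1_triangle _ μ₂ _).trans
    (add_le_add w₄ w₂))).trans_eq ?_)
  unfold gap
  rw [two_mul, ENNReal.ofReal_add (by positivity) (by positivity)]
  ring

theorem ofReal_tsub_add_tsub {a b : ℝ} (ha : 0 ≤ a) (hb : 0 ≤ b) :
    (ENNReal.ofReal a - ENNReal.ofReal b) + (ENNReal.ofReal b - ENNReal.ofReal a) =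
      ENNReal.ofReal |a - b| := by
  rw [← ENNReal.ofReal_sub _ hb, ← ENNReal.ofReal_sub _ ha]
  rcases le_total a b with h | h
  · rw [ENNReal.ofReal_of_nonpos (sub_nonpos.2 h), zero_add, abs_of_nonpos (sub_nonpos.2 h),
      neg_sub]
  · rw [ENNReal.ofReal_of_nonpos (sub_nonpos.2 h), add_zero, abs_of_nonneg (sub_nonneg.2 h)]

theorem sum_freq_eq_cellDiscrepancy [NeZero N] (R h : ℝ) (L : ℕ) (y : Fin N → E d)
    (ν : Fin N → Measure (E d)) [∀ i, IsProbabilityMeasure (ν i)] :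
    ∑ c ∈ cellBox d L,
      ((empFreq R h y c - meanFreq R h ν c) + (meanFreq R h ν c - empFreq R h y c)) =
    ENNReal.ofReal (cellDiscrepancy (cellIndex R h) (cellBox d L) ν y) := by
  have hN : 0 < (N : ℝ) := by exact_mod_cast Nat.pos_of_ne_zero (NeZero.ne N)
  have hN' : (N : ℝ≥0∞)⁻¹ = ENNReal.ofReal (N : ℝ)⁻¹ := by
    rw [ENNReal.ofReal_inv_of_pos hN]; simp
  unfold cellDiscrepancy
  rw [ENNReal.ofReal_sum_of_nonneg fun _ _ => abs_nonneg _]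
  refine Finset.sum_congr rfl fun c _ => ?_
  have e₁ : empFreq R h y c =
      ENNReal.ofReal ((N : ℝ)⁻¹ * ∑ i, if cellIndex R h (y i) = c then 1 else 0) := by
    rw [ENNReal.ofReal_mul (by positivity), empFreq, hN',
      ENNReal.ofReal_sum_of_nonneg fun _ _ => by split_ifs <;> norm_num]
    congr 1
    exact Finset.sum_congr rfl fun i _ => by split_ifs <;> simp
  have e₂ : meanFreq R h ν c =
      ENNReal.ofReal ((N : ℝ)⁻¹ * ∑ i, (ν i).real (cellIndex R h ⁻¹' {c})) := by
    rw [ENNReal.ofReal_mul (by positivity), meanFreq, hN',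
      ENNReal.ofReal_sum_of_nonneg fun _ _ => measureReal_nonneg]
    simp
  have h₁ : 0 ≤ (N : ℝ)⁻¹ * ∑ i, if cellIndex R h (y i) = c then (1 : ℝ) else 0 := by
    refine mul_nonneg (by positivity) (Finset.sum_nonneg fun _ _ => by split_ifs <;> norm_num)
  have h₂ : 0 ≤ (N : ℝ)⁻¹ * ∑ i, (ν i).real (cellIndex R h ⁻¹' {c}) :=
    mul_nonneg (by positivity) (Finset.sum_nonneg fun _ _ => measureReal_nonneg)
  rw [e₁, e₂, ofReal_tsub_add_tsub h₁ h₂, ← mul_sub, ← Finset.sum_sub_distrib]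

theorem lintegral_eval_pi {S : Type*} [MeasurableSpace S] (ν : Fin N → Measure S)
    [∀ i, IsProbabilityMeasure (ν i)] (i : Fin N) {g : S → ℝ≥0∞} (hg : Measurable g) :
    ∫⁻ y, g (y i) ∂(Measure.pi ν) = ∫⁻ s, g s ∂ν i := by
  rw [← (measurePreserving_eval ν i).map_eq, lintegral_map hg (measurable_pi_apply i)]

theorem add_four_rpow_le {p : ℝ} (hp : 1 ≤ p) (a b c e : ℝ≥0∞) :
    (a + b + c + e) ^ p ≤ 4 ^ (p - 1) * (a ^ p + b ^ p + c ^ p + e ^ p) := by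
  have h := ENNReal.rpow_sum_le_const_mul_sum_rpow Finset.univ ![a, b, c, e] hp
  simpa [Fin.sum_univ_four] using h

/-- The four summands of `gap` are separated by convexity: mesh, sampled tail (Rosenthal), mean tail
(Chebyshev), and frequencies (sub-Gaussian bound). -/
theorem lintegral_gap_rpow_le [NeZero N] {R h p : ℝ} {L : ℕ} (hR : 0 < R) (hh : 0 < h)
    (hL : R ≤ L * h) (hp : 1 < p) (ν : Fin N → Measure (E d)) [∀ i, IsProbabilityMeasure (ν i)]
    (hν : ∑ i, (N : ℝ≥0∞)⁻¹ * ∫⁻ v, ‖v‖ₑ ^ p ∂ν i ≤ 1) :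
    ∫⁻ y, gap R h L y ν ^ p ∂(Measure.pi ν) ≤ 4 ^ (p - 1) *
      (ENNReal.ofReal (2 * (d * h)) ^ p
        + (2 * (2 ^ (p - 1) * (N : ℝ≥0∞) ^ (1 - p))
          + (2 * (2 ^ (p - 1) * ENNReal.ofReal R ^ (1 - p))) ^ p)
        + (ENNReal.ofReal R ^ (1 - p)) ^ p
        + ENNReal.ofReal (d * (L * h)) ^ p * ENNReal.ofReal (2 ^ p * (2 ^ p + p ^ p) *
          Real.sqrt ((2 * L + 1) ^ d / N) ^ p)) := by
  have hp0 : 0 < p := by linarith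
  have hN0 : (N : ℝ≥0∞) ≠ 0 := by exact_mod_cast NeZero.ne N
  have htm := measurable_tailNorm (d := d) R
  have htail : ∑ i, (N : ℝ≥0∞)⁻¹ * ∫⁻ v, tailNorm R v ∂ν i ≤ ENNReal.ofReal R ^ (1 - p) := by
    calc ∑ i, (N : ℝ≥0∞)⁻¹ * ∫⁻ v, tailNorm R v ∂ν i
        ≤ ∑ i, (N : ℝ≥0∞)⁻¹ * (ENNReal.ofReal R ^ (1 - p) * ∫⁻ v, ‖v‖ₑ ^ p ∂ν i) := by
          refine Finset.sum_le_sum fun i _ => mul_le_mul_right ?_ _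
          rw [← lintegral_const_mul _ (by fun_prop)]
          exact lintegral_mono fun v => tailNorm_le hR hp.le v
      _ = ENNReal.ofReal R ^ (1 - p) * ∑ i, (N : ℝ≥0∞)⁻¹ * ∫⁻ v, ‖v‖ₑ ^ p ∂ν i := by
          rw [Finset.mul_sum]
          exact Finset.sum_congr rfl fun i _ => by ring
      _ ≤ ENNReal.ofReal R ^ (1 - p) * 1 := by gcongr
      _ = _ := mul_one _
  have hpow : ∑ i, ∫⁻ y, ((N : ℝ≥0∞)⁻¹ * tailNorm R ((y : Fin N → E d) i)) ^ p ∂(Measure.pi ν)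
      ≤ (N : ℝ≥0∞) ^ (1 - p) := by
    have e : (N : ℝ≥0∞)⁻¹ ^ p = (N : ℝ≥0∞) ^ (1 - p) * (N : ℝ≥0∞)⁻¹ := by
      rw [← ENNReal.rpow_neg_one, ← ENNReal.rpow_mul, ← ENNReal.rpow_add _ _ hN0 (by simp)]
      congr 1; ring
    calc ∑ i, ∫⁻ y, ((N : ℝ≥0∞)⁻¹ * tailNorm R ((y : Fin N → E d) i)) ^ p ∂(Measure.pi ν)
        ≤ ∑ i, (N : ℝ≥0∞) ^ (1 - p) * ((N : ℝ≥0∞)⁻¹ * ∫⁻ v, ‖v‖ₑ ^ p ∂ν i) := by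
          refine Finset.sum_le_sum fun i _ => ?_
          rw [lintegral_eval_pi ν i (g := fun v => ((N : ℝ≥0∞)⁻¹ * tailNorm R v) ^ p)
            (by fun_prop), ← mul_assoc, ← e, ← lintegral_const_mul _ (by fun_prop)]
          refine lintegral_mono fun v => ?_
          dsimp only
          rw [ENNReal.mul_rpow_of_nonneg _ _ hp0.le]
          gcongr
          unfold tailNorm
          split_ifs
          · exact zero_le
          · exact le_rfl
      _ = (N : ℝ≥0∞) ^ (1 - p) * ∑ i, (N : ℝ≥0∞)⁻¹ * ∫⁻ v, ‖v‖ₑ ^ p ∂ν i := by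
          rw [Finset.mul_sum]
      _ ≤ (N : ℝ≥0∞) ^ (1 - p) * 1 := by gcongr
      _ = _ := mul_one _
  have hfirst : ∑ i, ∫⁻ y, (N : ℝ≥0∞)⁻¹ * tailNorm R ((y : Fin N → E d) i) ∂(Measure.pi ν)
      ≤ ENNReal.ofReal R ^ (1 - p) := by
    refine le_trans (le_of_eq (Finset.sum_congr rfl fun i _ => ?_)) htail
    rw [lintegral_eval_pi ν i (g := fun v => (N : ℝ≥0∞)⁻¹ * tailNorm R v) (by fun_prop),
      lintegral_const_mul _ (by fun_prop)]
  have hros := lintegral_sum_rpow_le_of_iIndepFun (P := Measure.pi ν)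
    (Y := fun i y => (N : ℝ≥0∞)⁻¹ * tailNorm R (y i)) (fun i => by fun_prop)
    (iIndepFun_pi (X := fun _ v => (N : ℝ≥0∞)⁻¹ * tailNorm R v) fun i => by fun_prop) hp
  have hros' : ∫⁻ y, (∑ i, (N : ℝ≥0∞)⁻¹ * tailNorm R ((y : Fin N → E d) i)) ^ p ∂(Measure.pi ν) ≤
      2 * (2 ^ (p - 1) * (N : ℝ≥0∞) ^ (1 - p))
          + (2 * (2 ^ (p - 1) * ENNReal.ofReal R ^ (1 - p))) ^ p := by
    refine hros.trans ?_
    gcongr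
  have hdis := lintegral_cellDiscrepancy_rpow_le (measurable_cellIndex (d := d) R h)
    (cellIndex_mem_cellBox hh hL) (by rw [card_cellBox]; exact Nat.one_le_pow _ _ (by omega)) ν hp0
  rw [card_cellBox] at hdis
  push_cast at hdis
  have hdm := measurable_cellDiscrepancy (measurable_cellIndex (d := d) R h) (cellBox d L) ν
  simp only [gap, sum_freq_eq_cellDiscrepancy]
  refine (lintegral_mono fun y => add_four_rpow_le hp.le _ _ _ _).trans ?_
  rw [lintegral_const_mul _ (by fun_prop), lintegral_add_left (by fun_prop),
    lintegral_add_left (by fun_prop), lintegral_add_left (by fun_prop)]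
  simp only [lintegral_const, measure_univ, mul_one]
  simp_rw [ENNReal.mul_rpow_of_nonneg (ENNReal.ofReal (d * (L * h))) _ hp0.le]
  rw [lintegral_const_mul _ (by fun_prop)]
  gcongr

/-- With the radius `N ^ (1 / (p (d + 2)))` and about `N ^ (1 / (d + 2))` cells along each axis,
the `p`-th moment of the gap is of order `N ^ (-(p - 1) / (d + 2))`. -/
theorem exists_lintegral_gap_rpow_le (d : ℕ) {α : ℝ} (hα : 0 < α) :
    ∃ C : ℝ, 0 < C ∧ ∀ N : ℕ, ∀ [NeZero N], ∃ (R h : ℝ) (L : ℕ), 0 < h ∧ R ≤ L * h ∧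
      ∀ ν : Fin N → Measure (E d), ∀ [∀ i, IsProbabilityMeasure (ν i)],
        ∑ i, (N : ℝ≥0∞)⁻¹ * ∫⁻ v, ‖v‖ₑ ^ (1 + α) ∂ν i ≤ 1 →
        ∫⁻ y, gap R h L y ν ^ (1 + α) ∂(Measure.pi ν) ≤
          ENNReal.ofReal (C * (N : ℝ) ^ (-(α / ((d : ℝ) + 2)))) := by
  set p := 1 + α with hpdef
  have hp : 1 < p := by linarith
  have hp0 : 0 < p := by linarith
  -- One constant per term of the previous bound. The `5` arises from `2L + 1 ≤ 5 ell`, as `L ≤ 2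
  -- ell` and `1 ≤ ell`.
  let K : ℝ≥0∞ := 4 ^ (p - 1) * (ENNReal.ofReal ((2 * d) ^ p)
    + (2 * 2 ^ (p - 1) + (2 * 2 ^ (p - 1)) ^ p) + 1
    + ENNReal.ofReal (d ^ p * (2 ^ p * (2 ^ p + p ^ p)) * (5 ^ d) ^ p))
  have hK : K ≠ ∞ := by
    have h1 : ∀ a : ℝ≥0∞, a ≠ ∞ → a ^ (p - 1) ≠ ∞ := fun a ha =>
      ENNReal.rpow_ne_top_of_nonneg (by linarith) ha
    have h2 := h1 2 (by simp)
    have h4 := h1 4 (by simp)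
    have h3 : (2 * 2 ^ (p - 1) : ℝ≥0∞) ^ p ≠ ∞ :=
      ENNReal.rpow_ne_top_of_nonneg hp0.le (ENNReal.mul_ne_top (by simp) h2)
    have h5 : (2 * 2 ^ (p - 1) : ℝ≥0∞) ≠ ∞ := ENNReal.mul_ne_top (by simp) h2
    refine ENNReal.mul_ne_top h4 ?_
    simp [ENNReal.add_eq_top, h3, h5]
  refine ⟨K.toReal + 1, by positivity, fun N _ => ?_⟩
  have hN : (1 : ℝ) ≤ N := by exact_mod_cast Nat.pos_of_ne_zero (NeZero.ne N)
  have hN0 : (0 : ℝ) < N := by linarith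
  have hd2 : (0 : ℝ) < (d : ℝ) + 2 := by positivity
  set x : ℝ := (N : ℝ) with hx
  set b : ℝ := x ^ (-(α / ((d : ℝ) + 2))) with hb
  -- Here `R^p = ell` and `N = ell^{d+2}`, which balances the errors: up to constants, the mesh `(R
  -- / ell)^p`, the tail `(R^{1-p})^p` and the discrepancy `(R √(ell^d / N))^p` all equal `ell^{1-p}
  -- = b`.
  set R : ℝ := x ^ (1 / (p * ((d : ℝ) + 2))) with hR
  set ell : ℝ := x ^ (1 / ((d : ℝ) + 2)) with hell
  have hb0 : 0 < b := Real.rpow_pos_of_pos hN0 _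
  have hR0 : 0 < R := Real.rpow_pos_of_pos hN0 _
  have hell1 : 1 ≤ ell := Real.one_le_rpow hN (by positivity)
  have hell0 : 0 < ell := by linarith
  set L : ℕ := ⌈ell⌉₊ with hLdef
  have hL1 : ell ≤ L := Nat.le_ceil _
  have hL0 : (0 : ℝ) < L := by linarith
  have hL2 : (L : ℝ) ≤ 2 * ell := by
    have := (Nat.ceil_lt_add_one hell0.le).le
    linarith
  have hLh : (L : ℝ) * (R / L) = R := by field_simp
  have hRp : R ^ p = ell := by
    rw [hR, hell, ← Real.rpow_mul hN0.le]
    congr 1; field_simp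
  have hlb : ell * (ell ^ p)⁻¹ = b := by
    rw [← Real.rpow_neg hell0.le]
    conv_lhs => rw [← Real.rpow_one ell, ← Real.rpow_mul hell0.le, one_mul]
    rw [← Real.rpow_add hell0, hell, ← Real.rpow_mul hN0.le, hb, hpdef]
    congr 1; field_simp; ring
  refine ⟨R, R / L, L, by positivity, hLh.ge, fun ν _ hν => ?_⟩
  refine (lintegral_gap_rpow_le hR0 (by positivity) hLh.ge hp ν hν).trans ?_
  have t₁ : ENNReal.ofReal (2 * (d * (R / L))) ^ p ≤
      ENNReal.ofReal ((2 * d) ^ p) * ENNReal.ofReal b := by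
    rw [ENNReal.ofReal_rpow_of_nonneg (by positivity) hp0.le, ← ENNReal.ofReal_mul (by positivity)]
    refine ENNReal.ofReal_le_ofReal ?_
    rw [← mul_assoc, Real.mul_rpow (by positivity) (by positivity),
      Real.div_rpow hR0.le hL0.le, hRp, ← hlb, div_eq_mul_inv]
    gcongr
  have t₂ : (N : ℝ≥0∞) ^ (1 - p) ≤ ENNReal.ofReal b := by
    rw [← ENNReal.ofReal_natCast, ENNReal.ofReal_rpow_of_pos hN0]
    refine ENNReal.ofReal_le_ofReal (Real.rpow_le_rpow_of_exponent_le hN ?_)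
    have : α / ((d : ℝ) + 2) ≤ α := div_le_self hα.le (by linarith [Nat.cast_nonneg (α := ℝ) d])
    linarith
  have t₃ : (ENNReal.ofReal R ^ (1 - p)) ^ p = ENNReal.ofReal b := by
    rw [ENNReal.ofReal_rpow_of_pos hR0, ENNReal.ofReal_rpow_of_pos (Real.rpow_pos_of_pos hR0 _),
      hR, ← Real.rpow_mul hN0.le, ← Real.rpow_mul hN0.le, hb, hpdef]
    congr 2; field_simp; ring
  have t₄ : (2 * (2 ^ (p - 1) * ENNReal.ofReal R ^ (1 - p))) ^ p =
      (2 * 2 ^ (p - 1)) ^ p * ENNReal.ofReal b := by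
    rw [← mul_assoc, ENNReal.mul_rpow_of_nonneg _ _ hp0.le, t₃]
  have hsq : Real.sqrt ((2 * L + 1) ^ d / x) ≤ 5 ^ d * ell⁻¹ := by
    refine Real.sqrt_le_iff.2 ⟨by positivity, ?_⟩
    have h1 : (2 * (L : ℝ) + 1) ^ d ≤ (5 * ell) ^ d := by gcongr; linarith
    have h2 : x = ell ^ d * ell ^ 2 := by
      rw [← pow_add, ← Real.rpow_natCast, hell, ← Real.rpow_mul hN0.le]
      push_cast
      rw [one_div_mul_cancel hd2.ne', Real.rpow_one]
    have h3 : (1 : ℝ) ≤ 5 ^ d := one_le_pow₀ (by norm_num)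
    calc (2 * (L : ℝ) + 1) ^ d / x ≤ (5 * ell) ^ d / (ell ^ d * ell ^ 2) := by
          rw [← h2]; gcongr
      _ = 5 ^ d * (ell⁻¹) ^ 2 := by rw [mul_pow]; field_simp
      _ ≤ (5 ^ d * ell⁻¹) ^ 2 := by
          rw [mul_pow]
          gcongr
          nlinarith
  have t₅ : ENNReal.ofReal (d * (L * (R / L))) ^ p * ENNReal.ofReal (2 ^ p * (2 ^ p + p ^ p) *
      Real.sqrt ((2 * L + 1) ^ d / x) ^ p) ≤
      ENNReal.ofReal (d ^ p * (2 ^ p * (2 ^ p + p ^ p)) * (5 ^ d) ^ p) * ENNReal.ofReal b := by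
    rw [hLh, ENNReal.ofReal_rpow_of_nonneg (by positivity) hp0.le,
      ← ENNReal.ofReal_mul (by positivity), ← ENNReal.ofReal_mul (by positivity)]
    refine ENNReal.ofReal_le_ofReal ?_
    rw [Real.mul_rpow (by positivity) hR0.le, hRp]
    calc (d : ℝ) ^ p * ell * (2 ^ p * (2 ^ p + p ^ p) * Real.sqrt ((2 * L + 1) ^ d / x) ^ p)
        ≤ (d : ℝ) ^ p * ell * (2 ^ p * (2 ^ p + p ^ p) * (5 ^ d * ell⁻¹) ^ p) := by
          gcongr
      _ = _ := by
          rw [Real.mul_rpow (by positivity) (by positivity), Real.inv_rpow hell0.le, ← hlb]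
          ring
  have hfin : ENNReal.ofReal ((K.toReal + 1) * b) = ENNReal.ofReal (K.toReal + 1) *
      ENNReal.ofReal b := ENNReal.ofReal_mul (by positivity)
  have hKle : K ≤ ENNReal.ofReal (K.toReal + 1) := by
    conv_lhs => rw [← ENNReal.ofReal_toReal hK]
    exact ENNReal.ofReal_le_ofReal (by linarith)
  rw [hfin]
  refine le_trans ?_ (mul_le_mul_left hKle _)
  rw [t₃, t₄]
  calc _ ≤ 4 ^ (p - 1) * (ENNReal.ofReal ((2 * d) ^ p) * ENNReal.ofReal b
        + (2 * (2 ^ (p - 1) * ENNReal.ofReal b) + (2 * 2 ^ (p - 1)) ^ p * ENNReal.ofReal b)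
        + ENNReal.ofReal b
        + ENNReal.ofReal (d ^ p * (2 ^ p * (2 ^ p + p ^ p)) * (5 ^ d) ^ p) * ENNReal.ofReal b) := by
        gcongr
    _ = K * ENNReal.ofReal b := by ring

end Gap

end WeakInteraction

namespace WeakInteraction

namespace Model

/-! ### The Lipschitz constant on all pairs -/

section Lipschitz

variable {d m : ℕ} (M : Model d m)

theorem integrable_id_of_finiteFirstMoment {ρ : ProbabilityMeasure (E d)}
    (hρ : FiniteFirstMoment ρ) : Integrable (fun x => x) (ρ : Measure (E d)) :=
  ⟨aestronglyMeasurable_id, hρ⟩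

theorem edist_f_le_of_ne {z : E m} {ρ₁ ρ₂ : ProbabilityMeasure (E d)}
    (h₁ : FiniteFirstMoment ρ₁) (h₂ : FiniteFirstMoment ρ₂) {x₁ x₂ : E d} (hx : x₁ ≠ x₂)
    (hρ : ρ₁ ≠ ρ₂) :
    edist (M.f x₁ ρ₁ z) (M.f x₂ ρ₂ z) ≤ M.D z * (edist x₁ x₂ + W1 ρ₁ ρ₂) := by
  have h : edist (M.f x₁ ρ₁ z) (M.f x₂ ρ₂ z) / (edist x₁ x₂ + W1 ρ₁ ρ₂) ≤ M.D z := by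
    unfold D
    exact le_iSup_of_le x₁ (le_iSup_of_le x₂ (le_iSup_of_le ρ₁ (le_iSup_of_le ρ₂
      (le_iSup_of_le hx (le_iSup_of_le hρ (le_iSup_of_le h₁ (le_iSup_of_le h₂ le_rfl)))))))
  rwa [ENNReal.div_le_iff] at h
  · simp [hx]
  · simp [edist_ne_top, W1_ne_top h₁ h₂]

/-- The constant `D z` also controls pairs with equal points or equal measures, which the
supremum leaves out: go through a nearby third point and a nearby third measure. -/
theorem edist_f_le (hd : 1 ≤ d) {z : E m} (hz : M.D z ≠ ∞) {ρ₁ ρ₂ : ProbabilityMeasure (E d)}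
    (h₁ : FiniteFirstMoment ρ₁) (h₂ : FiniteFirstMoment ρ₂) (x₁ x₂ : E d) :
    edist (M.f x₁ ρ₁ z) (M.f x₂ ρ₂ z) ≤ M.D z * (edist x₁ x₂ + W1 ρ₁ ρ₂) := by
  let v : E d := EuclideanSpace.single ⟨0, hd⟩ (1 : ℝ)
  have hv : ‖v‖ = 1 := by simp [v]
  have hv0 : v ≠ 0 := by intro h; simp [h] at hv
  -- Of the two candidates `a + t • v` and `a + (t / 2) • v`, at most one equals `b`.
  have hpick : ∀ (t : ℝ), 0 < t → ∀ a b : E d, ∃ s : ℝ, 0 < s ∧ s ≤ t ∧ a + s • v ≠ b := by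
    intro t ht a b
    by_cases h : a + t • v = b
    · refine ⟨t / 2, by linarith, by linarith, fun h' => ?_⟩
      have h3 := smul_left_injective ℝ hv0 (add_left_cancel (h.trans h'.symm))
      linarith
    · exact ⟨t, ht, le_rfl, h⟩
  have key : ∀ t : ℝ≥0, 0 < t → edist (M.f x₁ ρ₁ z) (M.f x₂ ρ₂ z) ≤
      M.D z * (edist x₁ x₂ + W1 ρ₁ ρ₂ + 4 * t) := by
    intro t ht
    obtain ⟨s, hs, hst, hsx⟩ := hpick t ht x₁ x₂
    -- The third measure is a translate of `ρ₁`; its mean differs from those of `ρ₁` and `ρ₂`, which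
    -- separates it from both.
    obtain ⟨r, hr, hrt, hrm⟩ := hpick t ht (∫ x, x ∂(ρ₁ : Measure (E d)))
      (∫ x, x ∂(ρ₂ : Measure (E d)))
    let ρ : ProbabilityMeasure (E d) := ρ₁.map (f := fun x => x + r • v) (by fun_prop)
    have hρ : (ρ₁ : Measure (E d)).map (fun x => x + r • v) = ρ := rfl
    have he : ∀ s : ℝ, 0 < s → s ≤ t → ‖s • v‖ₑ ≤ t := by
      intro s hs hst
      rw [← ofReal_norm, norm_smul, hv, mul_one, Real.norm_of_nonneg hs.le]
      exact ENNReal.ofReal_le_of_le_toReal (by simpa using hst)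
    have hmean : ∫ x, x ∂(ρ : Measure (E d)) = (∫ x, x ∂(ρ₁ : Measure (E d))) + r • v := by
      rw [← hρ, integral_map (f := fun x => x) (by fun_prop)
        measurable_id.aestronglyMeasurable, integral_add (integrable_id_of_finiteFirstMoment h₁) (integrable_const _)]
      simp
    have hρm : FiniteFirstMoment ρ := by
      unfold FiniteFirstMoment
      rw [← hρ, lintegral_map (by fun_prop) (by fun_prop)]
      refine (lintegral_mono fun x => enorm_add_le _ _).trans_lt ?_
      rw [lintegral_add_left (by fun_prop)]
      exact ENNReal.add_lt_top.2 ⟨h₁, by simp⟩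
    have hρ₁ : ρ₁ ≠ ρ := by
      intro h
      rw [← h] at hmean
      exact smul_ne_zero hr.ne' hv0 (left_eq_add.1 hmean)
    have hρ₂ : ρ ≠ ρ₂ := by
      intro h
      rw [h] at hmean
      exact hrm hmean.symm
    have hx₁ : x₁ ≠ x₁ + s • v := by
      intro h
      exact smul_ne_zero hs.ne' hv0 (left_eq_add.1 h)
    have hW₁ : W1 ρ₁ ρ ≤ t := by
      refine (W1_le_lintegral_edist (P := (ρ₁ : Measure (E d))) measurable_id
        (by fun_prop) Measure.map_id hρ).trans ?_
      simp only [id, edist_eq_enorm_sub, sub_add_cancel_left, enorm_neg, lintegral_const,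
        measure_univ, mul_one]
      exact he r hr hrt
    have hW₁' : W1 ρ ρ₁ ≤ t := by
      refine (W1_le_lintegral_edist (P := (ρ₁ : Measure (E d))) (by fun_prop) measurable_id
        hρ Measure.map_id).trans ?_
      simp only [id, edist_eq_enorm_sub, add_sub_cancel_left, lintegral_const,
        measure_univ, mul_one]
      exact he r hr hrt
    have hW₂ : W1 ρ ρ₂ ≤ t + W1 ρ₁ ρ₂ :=
      (W1_triangle _ ρ₁ _).trans (add_le_add hW₁' le_rfl)
    have hd₁ : edist x₁ (x₁ + s • v) ≤ t := by
      rw [edist_eq_enorm_sub, sub_add_cancel_left, enorm_neg]; exact he s hs hst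
    have hd₂ : edist (x₁ + s • v) x₂ ≤ t + edist x₁ x₂ :=
      (edist_triangle _ x₁ _).trans (add_le_add ((edist_comm _ _).trans_le hd₁) le_rfl)
    calc edist (M.f x₁ ρ₁ z) (M.f x₂ ρ₂ z)
        ≤ edist (M.f x₁ ρ₁ z) (M.f (x₁ + s • v) ρ z)
          + edist (M.f (x₁ + s • v) ρ z) (M.f x₂ ρ₂ z) := edist_triangle _ _ _
      _ ≤ M.D z * (t + t) + M.D z * ((t + edist x₁ x₂) + (t + W1 ρ₁ ρ₂)) := by
          refine add_le_add ((M.edist_f_le_of_ne h₁ hρm hx₁ hρ₁).trans ?_)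
            ((M.edist_f_le_of_ne hρm h₂ hsx hρ₂).trans ?_)
          · gcongr
          · gcongr
      _ = M.D z * (edist x₁ x₂ + W1 ρ₁ ρ₂ + 4 * t) := by ring
  -- Since `M.D z` is finite, the detour cost `4 t D(z)` can be made smaller than any `ε`.
  refine ENNReal.le_of_forall_pos_le_add fun ε hε _ => ?_
  have hpos : 0 < ε / (4 * (M.D z).toNNReal + 1) := by positivity
  refine (key _ hpos).trans ?_
  rw [mul_add]
  gcongr
  rw [← ENNReal.coe_toNNReal hz]
  norm_cast
  rw [← mul_assoc, mul_div_assoc', div_le_iff₀ (by positivity)]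
  rw [mul_comm ε]
  gcongr
  rw [mul_comm]
  exact le_self_add

end Lipschitz

/-! ### One step of the dynamics and the Lipschitz bound for the nonlinear map -/

section Contraction

variable {d m : ℕ} (M : Model d m)

theorem measurable_step_comp {S : Type*} [MeasurableSpace S] {ρ : S → ProbabilityMeasure (E d)}
    {u : S → E d} {w : S → E m} (hρ : Measurable ρ) (hu : Measurable u) (hw : Measurable w) :
    Measurable fun s => M.step (ρ s) (u s) (w s) := by
  have h : Measurable fun s => M.f (u s) (ρ s) (w s) :=
    M.measurable_f.comp (hu.prodMk (hρ.prodMk hw))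
  exact (M.opA.continuous.measurable.comp hu).add (h.const_smul M.δ)

theorem enorm_opA_le {ω : ℝ} (hA : ‖M.opA‖ ≤ Real.exp (-ω)) (x : E d) :
    ‖M.opA x‖ₑ ≤ ENNReal.ofReal (Real.exp (-ω)) * ‖x‖ₑ := by
  rw [← ofReal_norm, ← ofReal_norm, ← ENNReal.ofReal_mul (Real.exp_pos _).le]
  exact ENNReal.ofReal_le_ofReal ((M.opA.le_opNorm x).trans (by gcongr))

theorem lintegral_ne_top_of_rpow {S : Type*} [MeasurableSpace S] {P : Measure S}
    [IsProbabilityMeasure P] {g : S → ℝ≥0∞} {p : ℝ} (hp : 1 ≤ p) (h : ∫⁻ s, g s ^ p ∂P < ∞) :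
    ∫⁻ s, g s ∂P ≠ ∞ := by
  have h1 : ∫⁻ s, g s ∂P ≤ ∫⁻ s, (1 + g s ^ p) ∂P := by
    refine lintegral_mono fun s => ?_
    rcases le_total (g s) 1 with h | h
    · exact h.trans le_self_add
    · refine le_trans ?_ le_add_self
      conv_lhs => rw [← ENNReal.rpow_one (g s)]
      exact ENNReal.rpow_le_rpow_of_exponent_le h hp
  refine ne_top_of_le_ne_top ?_ h1
  rw [lintegral_add_left measurable_const]
  simpa using h.ne

theorem map_prod_comp_left {S T U V : Type*} [MeasurableSpace S] [MeasurableSpace T]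
    [MeasurableSpace U] [MeasurableSpace V] {P : Measure S} {Q : Measure U} [SFinite Q]
    [SFinite P] {φ : S → T} (hφ : Measurable φ) {g : T × U → V} (hg : Measurable g) :
    (P.prod Q).map (fun q => g (φ q.1, q.2)) = ((P.map φ).prod Q).map g := by
  conv_rhs => rw [← Measure.map_id (μ := Q), Measure.map_prod_map _ _ hφ measurable_id,
    Measure.map_map hg (by fun_prop)]
  rfl

theorem lintegral_D_ne_top {α : ℝ} (hα : 0 < α) {μ₀ : ProbabilityMeasure (E d)}
    (hmom : M.MomentAssumption α μ₀) : ∫⁻ z, M.D z ∂(M.θ : Measure (E m)) ≠ ∞ :=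
  lintegral_ne_top_of_rpow (by linarith) hmom.lip

theorem ae_D_ne_top {α : ℝ} (hα : 0 < α) {μ₀ : ProbabilityMeasure (E d)}
    (hmom : M.MomentAssumption α μ₀) : ∀ᵐ z ∂(M.θ : Measure (E m)), M.D z ≠ ∞ :=
  (ae_lt_top' hmom.aemeasurable_D (M.lintegral_D_ne_top hα hmom)).mono fun _ h => h.ne

theorem measurable_D₁ : Measurable M.D₁ := by
  unfold D₁
  refine Measurable.enorm ?_
  exact M.measurable_f.comp
    (measurable_const.prodMk (measurable_const.prodMk measurable_id))

theorem edist_step_le (hd : 1 ≤ d) {ω : ℝ} (hA : ‖M.opA‖ ≤ Real.exp (-ω)) (hδ : 0 ≤ M.δ)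
    {z : E m} (hz : M.D z ≠ ∞) {ρ₁ ρ₂ : ProbabilityMeasure (E d)}
    (h₁ : FiniteFirstMoment ρ₁) (h₂ : FiniteFirstMoment ρ₂) (x₁ x₂ : E d) :
    edist (M.step ρ₁ x₁ z) (M.step ρ₂ x₂ z) ≤ ENNReal.ofReal (Real.exp (-ω)) * edist x₁ x₂
      + ENNReal.ofReal M.δ * (M.D z * (edist x₁ x₂ + W1 ρ₁ ρ₂)) := by
  unfold step
  refine (edist_add_add_le _ _ _ _).trans (add_le_add ?_ ?_)
  · rw [edist_eq_enorm_sub, ← map_sub, edist_eq_enorm_sub]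
    exact M.enorm_opA_le hA _
  · rw [edist_eq_enorm_sub, ← smul_sub, enorm_smul, ← edist_eq_enorm_sub,
      Real.enorm_eq_ofReal hδ]
    gcongr
    exact M.edist_f_le hd hz h₁ h₂ x₁ x₂

theorem finiteFirstMoment_diracProba_zero : FiniteFirstMoment (diracProba (0 : E d)) := by
  unfold FiniteFirstMoment
  simp [diracProba]

/-- Comparison with the step from the origin under the Dirac mass there. Keeping four separate
summands is what later produces the factor `4 ^ α`. -/
theorem enorm_step_le (hd : 1 ≤ d) {ω : ℝ} (hA : ‖M.opA‖ ≤ Real.exp (-ω)) (hδ : 0 ≤ M.δ)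
    {z : E m} (hz : M.D z ≠ ∞) {ρ : ProbabilityMeasure (E d)} (h : FiniteFirstMoment ρ) (x : E d) :
    ‖M.step ρ x z‖ₑ ≤ ENNReal.ofReal (Real.exp (-ω)) * ‖x‖ₑ
      + ENNReal.ofReal M.δ * (M.D z * ‖x‖ₑ)
      + ENNReal.ofReal M.δ * (M.D z * ∫⁻ y, ‖y‖ₑ ∂(ρ : Measure (E d)))
      + ENNReal.ofReal M.δ * M.D₁ z := by
  have h0 : ‖M.step (diracProba 0) 0 z‖ₑ = ENNReal.ofReal M.δ * M.D₁ z := by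
    simp [step, D₁, enorm_smul, Real.enorm_eq_ofReal hδ]
  have h1 := M.edist_step_le hd hA hδ hz h finiteFirstMoment_diracProba_zero x 0
  have h2 : ‖M.step ρ x z‖ₑ ≤ edist (M.step ρ x z) (M.step (diracProba 0) 0 z) +
      ‖M.step (diracProba 0) 0 z‖ₑ := by
    rw [← edist_zero_right, ← edist_zero_right]; exact edist_triangle _ _ _
  rw [h0] at h2
  refine h2.trans ?_
  rw [edist_zero_right] at h1
  refine add_le_add (h1.trans ?_) le_rfl
  rw [mul_add, mul_add, ← add_assoc]
  gcongr
  exact W1_dirac_le ρ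

theorem coe_Psi (μ : ProbabilityMeasure (E d)) : (M.Psi μ : Measure (E d)) =
    ((μ : Measure (E d)).prod (M.θ : Measure (E m))).map fun p => M.step μ p.1 p.2 := rfl

theorem finiteFirstMoment_Psi (hd : 1 ≤ d) {ω α : ℝ} (hA : ‖M.opA‖ ≤ Real.exp (-ω))
    (hδ : 0 ≤ M.δ) (hα : 0 < α) {μ₀ : ProbabilityMeasure (E d)} (hmom : M.MomentAssumption α μ₀)
    {μ : ProbabilityMeasure (E d)} (h : FiniteFirstMoment μ) : FiniteFirstMoment (M.Psi μ) := by
  have hm := M.measurable_step μ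
  have hD := hmom.aemeasurable_D
  have hD₁ := M.measurable_D₁
  have hs := M.lintegral_D_ne_top hα hmom
  have hs₁ : ∫⁻ z, M.D₁ z ∂(M.θ : Measure (E m)) ≠ ∞ :=
    lintegral_ne_top_of_rpow (by linarith) hmom.base
  unfold FiniteFirstMoment at *
  rw [coe_Psi, lintegral_map (by fun_prop) hm, lintegral_prod _ (by fun_prop)]
  have hb : ∀ x, ∫⁻ z, ‖M.step μ x z‖ₑ ∂(M.θ : Measure (E m)) ≤
      (ENNReal.ofReal (Real.exp (-ω)) +
        ENNReal.ofReal M.δ * ∫⁻ z, M.D z ∂(M.θ : Measure (E m))) * ‖x‖ₑ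
      + ENNReal.ofReal M.δ * ((∫⁻ z, M.D z ∂(M.θ : Measure (E m))) *
        ∫⁻ y, ‖y‖ₑ ∂(μ : Measure (E d)))
      + ENNReal.ofReal M.δ * ∫⁻ z, M.D₁ z ∂(M.θ : Measure (E m)) := by
    intro x
    refine (lintegral_mono_ae ((M.ae_D_ne_top hα hmom).mono fun z hz =>
      M.enorm_step_le hd hA hδ hz h x)).trans_eq ?_
    rw [lintegral_add_right _ (by fun_prop), lintegral_add_left' (by fun_prop),
      lintegral_add_left' (by fun_prop), lintegral_const_mul _ hD₁,
      lintegral_const_mul'' _ (by fun_prop), lintegral_const_mul'' _ (by fun_prop),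
      lintegral_const_mul'' _ (by fun_prop), lintegral_mul_const'' _ hD, lintegral_mul_const'' _ hD]
    simp only [lintegral_const, measure_univ, mul_one]
    ring
  refine (lintegral_mono hb).trans_lt ?_
  rw [lintegral_add_left (by fun_prop), lintegral_add_left (by fun_prop),
    lintegral_const_mul _ (by fun_prop)]
  simp only [lintegral_const, measure_univ, mul_one]
  exact ENNReal.add_lt_top.2 ⟨ENNReal.add_lt_top.2 ⟨ENNReal.mul_lt_top (ENNReal.add_lt_top.2
    ⟨by simp, ENNReal.mul_lt_top (by simp) hs.lt_top⟩) h, ENNReal.mul_lt_top (by simp)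
    (ENNReal.mul_lt_top hs.lt_top h)⟩, ENNReal.mul_lt_top (by simp) hs₁.lt_top⟩

theorem finiteFirstMoment_init {α : ℝ} (hα : 0 < α) {μ₀ : ProbabilityMeasure (E d)}
    (hmom : M.MomentAssumption α μ₀) : FiniteFirstMoment μ₀ :=
  (lintegral_ne_top_of_rpow (by linarith) hmom.init).lt_top

theorem finiteFirstMoment_law (hd : 1 ≤ d) {ω α : ℝ} (hA : ‖M.opA‖ ≤ Real.exp (-ω))
    (hδ : 0 ≤ M.δ) (hα : 0 < α) {μ₀ : ProbabilityMeasure (E d)} (hmom : M.MomentAssumption α μ₀)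
    (n : ℕ) : FiniteFirstMoment (M.law μ₀ n) := by
  induction n with
  | zero => exact M.finiteFirstMoment_init hα hmom
  | succ n ih => exact M.finiteFirstMoment_Psi hd hA hδ hα hmom ih

/-- Synchronous coupling: couple the positions arbitrarily and use the same noise for both. `D`
enters once through the positions and once through the measures, whence `2δσ` after the infimum over
couplings. -/
theorem W1_Psi_le (hd : 1 ≤ d) {ω α : ℝ} (hA : ‖M.opA‖ ≤ Real.exp (-ω))
    (hδ : 0 ≤ M.δ) (hα : 0 < α) {μ₀ : ProbabilityMeasure (E d)} (hmom : M.MomentAssumption α μ₀)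
    {μ ν : ProbabilityMeasure (E d)} (hμ : FiniteFirstMoment μ) (hν : FiniteFirstMoment ν) :
    W1 (M.Psi μ) (M.Psi ν) ≤
      ENNReal.ofReal (Real.exp (-ω) + 2 * M.δ * M.σ) * W1 μ ν := by
  have hσ : ENNReal.ofReal M.σ = ∫⁻ z, M.D z ∂(M.θ : Measure (E m)) :=
    ENNReal.ofReal_toReal (M.lintegral_D_ne_top hα hmom)
  have hσ0 : 0 ≤ M.σ := ENNReal.toReal_nonneg
  have hD := hmom.aemeasurable_D
  have key : ∀ π ∈ couplings μ ν, W1 (M.Psi μ) (M.Psi ν) ≤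
      ENNReal.ofReal (Real.exp (-ω) + M.δ * M.σ) * (∫⁻ p, edist p.1 p.2 ∂π)
        + ENNReal.ofReal (M.δ * M.σ) * W1 μ ν := by
    intro π hπ
    have := isProbabilityMeasure_of_coupling hπ
    have hg₁ : Measurable fun q : (E d × E d) × E m => M.step μ q.1.1 q.2 :=
      M.measurable_step_comp measurable_const (measurable_fst.comp measurable_fst) measurable_snd
    have hg₂ : Measurable fun q : (E d × E d) × E m => M.step ν q.1.2 q.2 :=
      M.measurable_step_comp measurable_const (measurable_snd.comp measurable_fst) measurable_snd
    have e₁ : (π.prod (M.θ : Measure (E m))).map (fun q => M.step μ q.1.1 q.2) = M.Psi μ := by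
      refine (map_prod_comp_left measurable_fst (M.measurable_step μ)).trans ?_
      rw [hπ.1, coe_Psi]
    have e₂ : (π.prod (M.θ : Measure (E m))).map (fun q => M.step ν q.1.2 q.2) = M.Psi ν := by
      refine (map_prod_comp_left measurable_snd (M.measurable_step ν)).trans ?_
      rw [hπ.2, coe_Psi]
    refine (W1_le_lintegral_edist hg₁ hg₂ e₁ e₂).trans ?_
    rw [lintegral_prod _ (by fun_prop)]
    have hb : ∀ q : E d × E d, ∫⁻ z, edist (M.step μ q.1 z) (M.step ν q.2 z)
        ∂(M.θ : Measure (E m)) ≤ ENNReal.ofReal (Real.exp (-ω) + M.δ * M.σ) * edist q.1 q.2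
          + ENNReal.ofReal (M.δ * M.σ) * W1 μ ν := by
      intro q
      refine (lintegral_mono_ae ((M.ae_D_ne_top hα hmom).mono fun z hz =>
        M.edist_step_le hd hA hδ hz hμ hν q.1 q.2)).trans_eq ?_
      rw [lintegral_add_left measurable_const, lintegral_const_mul'' _ (by fun_prop),
        lintegral_const_mul'' _ (by fun_prop), lintegral_mul_const'' _ hD, ← hσ, ENNReal.ofReal_add (by positivity) (by positivity),
        ENNReal.ofReal_mul hδ]
      simp only [lintegral_const, measure_univ, mul_one]
      ring
    refine (lintegral_mono hb).trans_eq ?_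
    rw [lintegral_add_right _ measurable_const, lintegral_const_mul _ (by fun_prop)]
    simp
  have hpos : ENNReal.ofReal (Real.exp (-ω) + M.δ * M.σ) ≠ 0 := by
    have : 0 < Real.exp (-ω) + M.δ * M.σ := by positivity
    simpa using this
  have : W1 (M.Psi μ) (M.Psi ν) ≤ ENNReal.ofReal (Real.exp (-ω) + M.δ * M.σ) * W1 μ ν
      + ENNReal.ofReal (M.δ * M.σ) * W1 μ ν := by
    conv_rhs => enter [1]; rw [W1, ENNReal.mul_iInf_of_ne hpos (by simp)]
    rw [ENNReal.iInf_add]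
    refine le_iInf fun π => ?_
    rw [ENNReal.mul_iInf_of_ne hpos (by simp), ENNReal.iInf_add]
    exact le_iInf fun hπ => key π hπ
  refine this.trans_eq ?_
  rw [← add_mul, ← ENNReal.ofReal_add (by positivity) (by positivity)]
  congr 2; ring

end Contraction

end Model

end WeakInteraction

namespace WeakInteraction

namespace Model

/-! ### The moment recursion -/

section Moments

variable {d m N : ℕ} [NeZero N] (M : Model d m)

/-- The average of the `p`-th powers of the norms of the particles. -/
noncomputable def avgPow (p : ℝ) (x : Fin N → E d) : ℝ≥0∞ := ∑ i, (N : ℝ≥0∞)⁻¹ * ‖x i‖ₑ ^ p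

/-- The conditional expectation of `avgPow p` after one step from the configuration `x`. -/
noncomputable def nextAvgPow (p : ℝ) (x : Fin N → E d) : ℝ≥0∞ :=
  ∑ i, (N : ℝ≥0∞)⁻¹ * ∫⁻ z, ‖M.step (empirical x) (x i) z‖ₑ ^ p ∂(M.θ : Measure (E m))

theorem finiteFirstMoment_empirical (x : Fin N → E d) : FiniteFirstMoment (empirical x) := by
  unfold FiniteFirstMoment
  rw [lintegral_empirical]
  refine ENNReal.sum_lt_top.2 fun i _ => ENNReal.mul_lt_top ?_ (by simp)
  rw [ENNReal.inv_lt_top]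
  exact_mod_cast Nat.pos_of_ne_zero (NeZero.ne N)

theorem sum_inv_card : ∑ _i : Fin N, (N : ℝ≥0∞)⁻¹ = 1 := by
  rw [Finset.sum_const, Finset.card_univ, Fintype.card_fin, nsmul_eq_mul]
  exact ENNReal.mul_inv_cancel (by exact_mod_cast NeZero.ne N) (by simp)

/-- Convexity applied to the four summands of `enorm_step_le`. By Jensen, the mean-field summand is
also bounded by `avgPow`, so the `D` term counts twice. -/
theorem nextAvgPow_le (hd : 1 ≤ d) {ω α : ℝ} (hA : ‖M.opA‖ ≤ Real.exp (-ω))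
    (hδ : 0 ≤ M.δ) (hα : 0 < α) {μ₀ : ProbabilityMeasure (E d)} (hmom : M.MomentAssumption α μ₀)
    (x : Fin N → E d) :
    M.nextAvgPow (1 + α) x ≤
      4 ^ α * (ENNReal.ofReal (Real.exp (-ω)) ^ (1 + α) + 2 * (ENNReal.ofReal M.δ ^ (1 + α) *
        ∫⁻ z, M.D z ^ (1 + α) ∂(M.θ : Measure (E m)))) * avgPow (1 + α) x
      + 4 ^ α * (ENNReal.ofReal M.δ ^ (1 + α) *
        ∫⁻ z, M.D₁ z ^ (1 + α) ∂(M.θ : Measure (E m))) := by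
  set p := 1 + α with hp
  have hp0 : 0 ≤ p := by linarith
  have hp1 : 1 ≤ p := by linarith
  have hD := hmom.aemeasurable_D
  have hD₁ := M.measurable_D₁
  set e := ENNReal.ofReal (Real.exp (-ω))
  set δ := ENNReal.ofReal M.δ
  set s := ∫⁻ z, M.D z ^ p ∂(M.θ : Measure (E m))
  set s₁ := ∫⁻ z, M.D₁ z ^ p ∂(M.θ : Measure (E m))
  have hmean : (∫⁻ y, ‖y‖ₑ ∂(empirical x : Measure (E d))) ^ p ≤ avgPow p x := by
    rw [lintegral_empirical]
    exact ENNReal.rpow_arith_mean_le_arith_mean_rpow _ _ _ sum_inv_card hp1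
  have hone : ∀ i, ∫⁻ z, ‖M.step (empirical x) (x i) z‖ₑ ^ p ∂(M.θ : Measure (E m)) ≤
      4 ^ α * ((e ^ p + δ ^ p * s) * ‖x i‖ₑ ^ p + δ ^ p * s * avgPow p x + δ ^ p * s₁) := by
    intro i
    calc ∫⁻ z, ‖M.step (empirical x) (x i) z‖ₑ ^ p ∂(M.θ : Measure (E m))
        ≤ ∫⁻ z, 4 ^ α * (e ^ p * ‖x i‖ₑ ^ p + (δ ^ p * ‖x i‖ₑ ^ p) * M.D z ^ p
            + (δ ^ p * avgPow p x) * M.D z ^ p + δ ^ p * M.D₁ z ^ p) ∂(M.θ : Measure (E m)) := by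
          refine lintegral_mono_ae ((M.ae_D_ne_top hα hmom).mono fun z hz => ?_)
          refine (ENNReal.rpow_le_rpow (M.enorm_step_le hd hA hδ hz
            (finiteFirstMoment_empirical x) (x i)) hp0).trans ?_
          refine (add_four_rpow_le hp1 _ _ _ _).trans ?_
          rw [show p - 1 = α by rw [hp]; ring]
          simp only [ENNReal.mul_rpow_of_nonneg _ _ hp0]
          refine mul_le_mul_right (add_le_add (add_le_add (add_le_add le_rfl ?_) ?_) le_rfl) _
          · rw [mul_comm (M.D z ^ p), mul_assoc]
          · rw [mul_comm (M.D z ^ p), mul_assoc]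
            gcongr
      _ = 4 ^ α * (e ^ p * ‖x i‖ₑ ^ p + (δ ^ p * ‖x i‖ₑ ^ p) * s
            + (δ ^ p * avgPow p x) * s + δ ^ p * s₁) := by
          rw [lintegral_const_mul'' _ (by fun_prop), lintegral_add_right _ (by fun_prop),
            lintegral_add_left' (by fun_prop), lintegral_add_left' (by fun_prop),
            lintegral_const_mul _ (hD₁.pow_const p), lintegral_const_mul'' _ (by fun_prop), lintegral_const_mul'' _ (by fun_prop),
            lintegral_const_mul'' _ (by fun_prop)]
          simp [s, s₁]
      _ = _ := by ring
  calc M.nextAvgPow p x ≤ ∑ i, (N : ℝ≥0∞)⁻¹ *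
        (4 ^ α * ((e ^ p + δ ^ p * s) * ‖x i‖ₑ ^ p + δ ^ p * s * avgPow p x + δ ^ p * s₁)) :=
        Finset.sum_le_sum fun i _ => mul_le_mul_right (hone i) _
    _ = 4 ^ α * ((e ^ p + δ ^ p * s) * ∑ i, (N : ℝ≥0∞)⁻¹ * ‖x i‖ₑ ^ p)
        + 4 ^ α * (δ ^ p * s * avgPow p x + δ ^ p * s₁) * ∑ _i : Fin N, (N : ℝ≥0∞)⁻¹ := by
        rw [Finset.mul_sum, Finset.mul_sum, Finset.mul_sum, ← Finset.sum_add_distrib]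
        exact Finset.sum_congr rfl fun i _ => by ring
    _ = 4 ^ α * ((e ^ p + δ ^ p * s) * avgPow p x)
        + 4 ^ α * (δ ^ p * s * avgPow p x + δ ^ p * s₁) := by
        rw [sum_inv_card, mul_one]; rfl
    _ = _ := by ring

/-- The factor in the recursion for the moments is smaller than one. -/
theorem moment_factor_lt_one {ω α : ℝ} (hα : 0 < α) {μ₀ : ProbabilityMeasure (E d)}
    (hmom : M.MomentAssumption α μ₀) (ha : 0 < M.a ω α) (hδ0 : 0 < M.δ)
    (hδ : M.δ < M.a ω α ^ (1 / (1 + α))) :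
    4 ^ α * (ENNReal.ofReal (Real.exp (-ω)) ^ (1 + α) + 2 * (ENNReal.ofReal M.δ ^ (1 + α) *
        ∫⁻ z, M.D z ^ (1 + α) ∂(M.θ : Measure (E m)))) < 1 := by
  have hp0 : 0 < 1 + α := by linarith
  have hs : ∫⁻ z, M.D z ^ (1 + α) ∂(M.θ : Measure (E m)) = ENNReal.ofReal (M.σ₁ α) :=
    (ENNReal.ofReal_toReal hmom.lip.ne).symm
  have hs0 : 0 ≤ M.σ₁ α := ENNReal.toReal_nonneg
  -- If `σ₁` were zero, division by zero would make `a` zero, against `ha`.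
  have hspos : 0 < M.σ₁ α := by
    refine hs0.lt_of_ne fun h => ?_
    simp [a, ← h] at ha
  have h1 : M.δ ^ (1 + α) < M.a ω α := by
    have := Real.rpow_lt_rpow hδ0.le hδ hp0
    rwa [← Real.rpow_mul ha.le, one_div_mul_cancel hp0.ne', Real.rpow_one] at this
  unfold a at h1
  rw [lt_div_iff₀ (by positivity)] at h1
  have e4 : (4 : ℝ≥0∞) ^ α = ENNReal.ofReal (4 ^ α) := by
    rw [← ENNReal.ofReal_rpow_of_pos (by norm_num)]; norm_num
  have e2 : (2 : ℝ≥0∞) = ENNReal.ofReal 2 := by norm_num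
  have h4 : (0 : ℝ) < 4 ^ α := by positivity
  have hee : Real.exp (-ω) ^ (1 + α) = Real.exp (-(1 + α) * ω) := by
    rw [← Real.exp_mul]; congr 1; ring
  rw [hs, e4, e2, ENNReal.ofReal_rpow_of_pos (Real.exp_pos _), ENNReal.ofReal_rpow_of_pos hδ0,
    ← ENNReal.ofReal_mul (by positivity), ← ENNReal.ofReal_mul (by positivity),
    ← ENNReal.ofReal_add (by positivity) (by positivity), ← ENNReal.ofReal_mul (by positivity),
    ENNReal.ofReal_lt_one, hee]
  have h5 : Real.exp (-(1 + α) * ω) + 2 * (M.δ ^ (1 + α) * M.σ₁ α) < 4 ^ (-α) := by linarith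
  calc (4 : ℝ) ^ α * (Real.exp (-(1 + α) * ω) + 2 * (M.δ ^ (1 + α) * M.σ₁ α))
      < 4 ^ α * 4 ^ (-α) := by gcongr
    _ = 1 := by rw [← Real.rpow_add (by norm_num)]; simp

theorem measurable_empirical : Measurable fun x : Fin N → E d => empirical x := by
  refine Measurable.subtype_mk ?_
  refine Measure.measurable_of_measurable_coe _ fun s hs => ?_
  simp only [Measure.smul_apply, Measure.coe_finsetSum, Finset.sum_apply, smul_eq_mul]
  refine Measurable.const_mul (Finset.measurable_fun_sum _ fun i _ => ?_) _
  exact (Measure.measurable_coe hs).comp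
    (Measure.measurable_dirac.comp (measurable_pi_apply i))

theorem measurable_step_empirical (i : Fin N) : Measurable fun q : (Fin N → E d) × E m =>
    M.step (empirical q.1) (q.1 i) q.2 :=
  M.measurable_step_comp (measurable_empirical.comp measurable_fst)
    ((measurable_pi_apply i).comp measurable_fst) measurable_snd

theorem measurable_nextAvgPow (p : ℝ) : Measurable (M.nextAvgPow (N := N) p) := by
  unfold nextAvgPow
  refine Finset.measurable_fun_sum _ fun i _ => Measurable.const_mul ?_ _
  exact Measurable.lintegral_prod_right' (f := fun q : (Fin N → E d) × E m =>
    ‖M.step (empirical q.1) (q.1 i) q.2‖ₑ ^ p) ((M.measurable_step_empirical i).enorm.pow_const p)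

end Moments

/-! ### Independence of the present from the future noise -/

section Independence

variable {d m N : ℕ} [NeZero N] {M : Model d m} {μ₀ : ProbabilityMeasure (E d)}
  {Ω : Type*} [MeasurableSpace Ω] {P : Measure Ω}
  {X : ℕ → Fin N → Ω → E d} {ξ : ℕ → Fin N → Ω → E m}

theorem indepFun_prodMk_of_indepFun [IsProbabilityMeasure P] {A B C : Type*} [MeasurableSpace A] [MeasurableSpace B]
    [MeasurableSpace C] {f : Ω → A} {g : Ω → B} {h : Ω → C} (hf : Measurable f)
    (hg : Measurable g) (hh : Measurable h) (h₁ : IndepFun f (fun w => (g w, h w)) P)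
    (h₂ : IndepFun g h P) : IndepFun (fun w => (f w, g w)) h P := by
  have hPf := Measure.isProbabilityMeasure_map (μ := P) hf.aemeasurable
  have hPg := Measure.isProbabilityMeasure_map (μ := P) hg.aemeasurable
  have hPh := Measure.isProbabilityMeasure_map (μ := P) hh.aemeasurable
  have h₃ : IndepFun f g P := h₁.comp measurable_id measurable_fst
  rw [indepFun_iff_map_prod_eq_prod_map_map (by fun_prop) (by fun_prop)] at h₁ h₂ h₃ ⊢
  rw [h₃]
  rw [h₂] at h₁
  have e : (fun w => ((f w, g w), h w)) =
      MeasurableEquiv.prodAssoc.symm ∘ fun w => (f w, (g w, h w)) := rfl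
  rw [e, ← Measure.map_map (MeasurableEquiv.measurable _) (by fun_prop), h₁,
    ← Measure.prodAssoc_prod, MeasurableEquiv.map_symm_map]

theorem IsParticleSystem.measurable (h : M.IsParticleSystem μ₀ P X ξ) (n : ℕ) (i : Fin N) :
    Measurable (X n i) := by
  induction n generalizing i with
  | zero => exact h.measurable_init i
  | succ n ih =>
    have : X (n + 1) i = fun w => M.step (empirical fun j => X n j w) (X n i w) (ξ n i w) :=
      funext fun w => h.dynamics n i w
    rw [this]
    exact M.measurable_step_comp (measurable_empirical.comp (measurable_pi_lambda _ fun j => ih j))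
      (ih i) (h.measurable_noise n i)

theorem IsParticleSystem.indepFun_noise_future (h : M.IsParticleSystem μ₀ P X ξ) (n : ℕ) :
    IndepFun (fun w i => ξ n i w) (fun w (q : ℕ × Fin N) => ξ (n + 1 + q.1) q.2 w) P := by
  have hle : ∀ q : ℕ × Fin N, MeasurableSpace.comap (fun w => ξ q.1 q.2 w) inferInstance ≤
      (inferInstance : MeasurableSpace Ω) := fun q => (h.measurable_noise q.1 q.2).comap_le
  have hdis : Disjoint {q : ℕ × Fin N | q.1 = n} {q : ℕ × Fin N | n < q.1} := by
    rw [Set.disjoint_left]; intro q h1 h2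
    simp only [Set.mem_ofPred_eq] at h1 h2; omega
  have hI := indep_iSup_of_disjoint hle h.indep_noise hdis
  rw [IndepFun_iff_Indep]
  refine indep_of_indep_of_le_left (indep_of_indep_of_le_right hI ?_) ?_
  · rw [MeasurableSpace.pi, MeasurableSpace.comap_iSup]
    refine iSup_le fun q => ?_
    rw [MeasurableSpace.comap_comp]
    exact le_iSup₂_of_le (n + 1 + q.1, q.2) (by simp only [Set.mem_ofPred_eq]; omega) le_rfl
  · rw [MeasurableSpace.pi, MeasurableSpace.comap_iSup]
    refine iSup_le fun i => ?_
    rw [MeasurableSpace.comap_comp]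
    exact le_iSup₂_of_le (n, i) rfl le_rfl

/-- Induction in time: the new configuration is a function of the old one and the current noise, a
pair independent of all later noise. -/
theorem IsParticleSystem.indepFun_future [IsProbabilityMeasure P]
    (h : M.IsParticleSystem μ₀ P X ξ) (n : ℕ) :
    IndepFun (fun w i => X n i w) (fun w (q : ℕ × Fin N) => ξ (n + q.1) q.2 w) P := by
  induction n with
  | zero => simpa using h.indep_init_noise
  | succ n ih =>
    have hX : Measurable fun w i => X n i w := measurable_pi_lambda _ fun i => h.measurable n i
    have hξ : Measurable fun w i => ξ n i w :=
      measurable_pi_lambda _ fun i => h.measurable_noise n i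
    have hF : Measurable fun w (q : ℕ × Fin N) => ξ (n + 1 + q.1) q.2 w :=
      measurable_pi_lambda _ fun q => h.measurable_noise _ _
    have h₁ : IndepFun (fun w i => X n i w)
        (fun w => ((fun i => ξ n i w), fun q : ℕ × Fin N => ξ (n + 1 + q.1) q.2 w)) P := by
      have hφ : Measurable fun u : ℕ × Fin N → E m =>
          ((fun i => u (0, i)), fun q : ℕ × Fin N => u (1 + q.1, q.2)) := by fun_prop
      have := ih.comp measurable_id hφ
      simpa [Function.comp_def, add_assoc] using this
    have h₂ := indepFun_prodMk_of_indepFun hX hξ hF h₁ (h.indepFun_noise_future n)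
    have hψ : Measurable fun q : (Fin N → E d) × (Fin N → E m) =>
        fun i => M.step (empirical q.1) (q.1 i) (q.2 i) :=
      measurable_pi_lambda _ fun i => M.measurable_step_comp
        (measurable_empirical.comp measurable_fst)
        ((measurable_pi_apply i).comp measurable_fst) ((measurable_pi_apply i).comp measurable_snd)
    have h₃ := h₂.comp hψ measurable_id
    have e : (fun w i => X (n + 1) i w) = (fun q : (Fin N → E d) × (Fin N → E m) =>
        fun i => M.step (empirical q.1) (q.1 i) (q.2 i)) ∘
          fun w => ((fun i => X n i w), fun i => ξ n i w) := by
      funext w i; exact h.dynamics n i w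
    rw [e]
    exact h₃

/-- This replaces conditioning on the configuration: expectations over one step become iterated
integrals. -/
theorem IsParticleSystem.map_position_noise [IsProbabilityMeasure P]
    (h : M.IsParticleSystem μ₀ P X ξ) (n : ℕ) :
    P.map (fun w => ((fun i => X n i w), fun i => ξ n i w)) =
      (P.map fun w i => X n i w).prod (Measure.pi fun _ : Fin N => (M.θ : Measure (E m))) := by
  have hX : Measurable fun w i => X n i w := measurable_pi_lambda _ fun i => h.measurable n i
  have hξ : Measurable fun w i => ξ n i w :=
    measurable_pi_lambda _ fun i => h.measurable_noise n i
  have h₁ : IndepFun (fun w i => X n i w) (fun w i => ξ n i w) P := by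
    have hφ : Measurable fun u : ℕ × Fin N → E m => fun i => u (0, i) := by fun_prop
    simpa [Function.comp_def] using (h.indepFun_future n).comp measurable_id hφ
  rw [(indepFun_iff_map_prod_eq_prod_map_map hX.aemeasurable hξ.aemeasurable).1 h₁]
  congr 1
  have h₂ : iIndepFun (fun i w => ξ n i w) P :=
    h.indep_noise.precomp (g := fun i : Fin N => (n, i)) fun i j hij => by simpa using hij
  rw [(iIndepFun_iff_map_fun_eq_pi_map fun i => (h.measurable_noise n i).aemeasurable).1 h₂]
  congr 1
  funext i
  exact h.law_noise n i

end Independence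

end Model

end WeakInteraction

namespace WeakInteraction

namespace Model

/-! ### The sampling error from a fixed configuration -/

section OneStep

variable {d m N : ℕ} [NeZero N] (M : Model d m)

/-- The natural length scale of the configuration reached after one step from `x`. -/
noncomputable def scale (p : ℝ) (x : Fin N → E d) : ℝ :=
  ((M.nextAvgPow p x).toReal + 1) ^ (1 / p)

/-- The law of the rescaled position of particle `i` after one step from `x`. -/
noncomputable def scaledLaw (p : ℝ) (x : Fin N → E d) (i : Fin N) : Measure (E d) :=
  (M.θ : Measure (E m)).map fun z => (M.scale p x)⁻¹ • M.step (empirical x) (x i) z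

/-- The rescaled gap of the configuration reached from `x` with the noise `z`. -/
noncomputable def stepGap (p R h : ℝ) (L : ℕ) (x : Fin N → E d) (z : Fin N → E m) : ℝ≥0∞ :=
  ENNReal.ofReal (M.scale p x) *
    gap R h L (fun i => (M.scale p x)⁻¹ • M.step (empirical x) (x i) (z i)) (M.scaledLaw p x)

theorem scale_pos (p : ℝ) (x : Fin N → E d) : 0 < M.scale p x :=
  Real.rpow_pos_of_pos (by positivity) _

theorem ofReal_scale_rpow {p : ℝ} (hp : 0 < p) {x : Fin N → E d} (hx : M.nextAvgPow p x ≠ ∞) :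
    ENNReal.ofReal (M.scale p x) ^ p = M.nextAvgPow p x + 1 := by
  rw [ENNReal.ofReal_rpow_of_pos (M.scale_pos p x), scale, ← Real.rpow_mul (by positivity),
    one_div_mul_cancel hp.ne', Real.rpow_one, ENNReal.ofReal_add (by positivity) zero_le_one,
    ENNReal.ofReal_toReal hx, ENNReal.ofReal_one]

theorem measurable_scale (p : ℝ) : Measurable (M.scale (N := N) p) := by
  have := M.measurable_nextAvgPow (N := N) p
  unfold scale
  fun_prop

theorem measurable_scaled_step (p : ℝ) (i : Fin N) :
    Measurable fun q : (Fin N → E d) × E m =>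
      (M.scale p q.1)⁻¹ • M.step (empirical q.1) (q.1 i) q.2 :=
  ((M.measurable_scale p).comp measurable_fst).inv.smul (M.measurable_step_empirical i)

theorem measurable_step_const (x : Fin N → E d) (i : Fin N) :
    Measurable fun z : E m => M.step (empirical x) (x i) z :=
  M.measurable_step_comp measurable_const measurable_const measurable_id

theorem isProbabilityMeasure_scaledLaw (p : ℝ) (x : Fin N → E d) (i : Fin N) :
    IsProbabilityMeasure (M.scaledLaw p x i) :=
  Measure.isProbabilityMeasure_map
    ((M.measurable_step_const x i).const_smul (M.scale p x)⁻¹).aemeasurable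

theorem measurable_scaledLaw (p : ℝ) : Measurable (M.scaledLaw (N := N) p) := by
  refine measurable_pi_lambda _ fun i => Measure.measurable_of_measurable_coe _ fun s hs => ?_
  have h : ∀ x, M.scaledLaw p x i s = (M.θ : Measure (E m)) (Prod.mk x ⁻¹'
      ((fun q : (Fin N → E d) × E m => (M.scale p q.1)⁻¹ • M.step (empirical q.1) (q.1 i) q.2)
        ⁻¹' s)) := fun x =>
    Measure.map_apply ((M.measurable_step_const x i).const_smul (M.scale p x)⁻¹) hs
  simp_rw [h]
  exact measurable_measure_prodMk_left (M.measurable_scaled_step p i hs)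

theorem measurable_stepGap (p R h : ℝ) (L : ℕ) :
    Measurable fun q : (Fin N → E d) × (Fin N → E m) => M.stepGap p R h L q.1 q.2 := by
  have hs : Measurable fun q : (Fin N → E d) × (Fin N → E m) => M.scale p q.1 :=
    (M.measurable_scale p).comp measurable_fst
  have hY : Measurable fun (q : (Fin N → E d) × (Fin N → E m)) (i : Fin N) =>
      (M.scale p q.1)⁻¹ • M.step (empirical q.1) (q.1 i) (q.2 i) := by
    refine measurable_pi_lambda _ fun i => ?_
    have h₁ : Measurable fun q : (Fin N → E d) × (Fin N → E m) => empirical q.1 :=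
      measurable_empirical.comp measurable_fst
    have h₂ : Measurable fun q : (Fin N → E d) × (Fin N → E m) => q.1 i := by fun_prop
    have h₃ : Measurable fun q : (Fin N → E d) × (Fin N → E m) => q.2 i := by fun_prop
    exact hs.inv.smul (M.measurable_step_comp h₁ h₂ h₃)
  have hl : Measurable fun q : (Fin N → E d) × (Fin N → E m) => M.scaledLaw p q.1 :=
    (M.measurable_scaledLaw p).comp measurable_fst
  have hg : Measurable fun q : (Fin N → E d) × (Fin N → E m) =>
      gap R h L (fun i => (M.scale p q.1)⁻¹ • M.step (empirical q.1) (q.1 i) (q.2 i))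
        (M.scaledLaw p q.1) := measurable_gap_comp R h L hY hl
  exact hs.ennreal_ofReal.mul hg

/-- It identifies the centring: the empirical measure after a step is compared with the average of
the particles' conditional laws. -/
theorem coe_Psi_empirical (x : Fin N → E d) : (M.Psi (empirical x) : Measure (E d)) =
    (N : ℝ≥0∞)⁻¹ • ∑ i, (M.θ : Measure (E m)).map fun z => M.step (empirical x) (x i) z := by
  have hm := M.measurable_step (empirical x)
  ext s hs
  rw [coe_Psi, Measure.map_apply hm hs, Measure.prod_apply (hm hs), lintegral_empirical,
    Measure.smul_apply, Measure.coe_finsetSum, Finset.sum_apply, smul_eq_mul, Finset.mul_sum]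
  refine Finset.sum_congr rfl fun i _ => ?_
  rw [Measure.map_apply (M.measurable_step_const x i) hs]
  rfl

theorem W1_le_stepGap {p R h : ℝ} {L : ℕ} (hh : 0 < h) (hL : R ≤ L * h) (x : Fin N → E d)
    (z : Fin N → E m) :
    W1 (empirical fun i => M.step (empirical x) (x i) (z i)) (M.Psi (empirical x)) ≤
      M.stepGap p R h L x z := by
  set r := M.scale p x with hr
  have hr0 : 0 < r := M.scale_pos p x
  have hsm : Measurable fun v : E d => r⁻¹ • v := by fun_prop
  let ρ : ProbabilityMeasure (E d) := (M.Psi (empirical x)).map hsm.aemeasurable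
  have hρ : (ρ : Measure (E d)) = (N : ℝ≥0∞)⁻¹ • ∑ i, M.scaledLaw p x i := by
    change (M.Psi (empirical x) : Measure (E d)).map (fun v => r⁻¹ • v) = _
    rw [coe_Psi_empirical, Measure.map_smul, ← Measure.mapₗ_apply_of_measurable hsm, map_sum]
    congr 1
    refine Finset.sum_congr rfl fun i _ => ?_
    rw [Measure.mapₗ_apply_of_measurable hsm, Measure.map_map hsm (M.measurable_step_const x i)]
    rfl
  have h₁ : (empirical fun i => r⁻¹ • M.step (empirical x) (x i) (z i) : Measure (E d)).map
      (r • ·) = empirical fun i => M.step (empirical x) (x i) (z i) := by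
    have hm : Measurable fun v : E d => r • v := by fun_prop
    rw [coe_empirical, coe_empirical, Measure.map_smul, ← Measure.mapₗ_apply_of_measurable hm,
      map_sum]
    congr 1
    refine Finset.sum_congr rfl fun i _ => ?_
    rw [Measure.mapₗ_apply_of_measurable hm, Measure.map_dirac' hm, smul_inv_smul₀ hr0.ne']
  have h₂ : (ρ : Measure (E d)).map (r • ·) = M.Psi (empirical x) := by
    change ((M.Psi (empirical x) : Measure (E d)).map (fun v => r⁻¹ • v)).map (r • ·) = _
    rw [Measure.map_map (by fun_prop) hsm]
    have : ((r • ·) ∘ fun v : E d => r⁻¹ • v) = id := by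
      funext v; simp [smul_inv_smul₀ hr0.ne']
    rw [this, Measure.map_id]
  refine (W1_map_smul_le hr0.ne' h₁ h₂).trans ?_
  rw [Real.enorm_eq_ofReal hr0.le]
  exact mul_le_mul_right (W1_empirical_le_gap hh hL _ _ ρ hρ) _

/-- Dividing by `scale` brings the averaged moment to at most one, so `hgap` applies with a radius
independent of `x`; multiplying back costs `scale ^ p`. The `+ 1` in `scale` keeps it positive. -/
theorem lintegral_stepGap_rpow_le {p R h : ℝ} {L : ℕ} (hp : 0 < p) {B : ℝ≥0∞}
    (hgap : ∀ ν : Fin N → Measure (E d), ∀ [∀ i, IsProbabilityMeasure (ν i)],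
        ∑ i, (N : ℝ≥0∞)⁻¹ * ∫⁻ v, ‖v‖ₑ ^ p ∂ν i ≤ 1 →
        ∫⁻ y, gap R h L y ν ^ p ∂(Measure.pi ν) ≤ B)
    {x : Fin N → E d} (hx : M.nextAvgPow p x ≠ ∞) :
    ∫⁻ z, M.stepGap p R h L x z ^ p ∂(Measure.pi fun _ : Fin N => (M.θ : Measure (E m))) ≤
      (M.nextAvgPow p x + 1) * B := by
  have hr0 : 0 < M.scale p x := M.scale_pos p x
  have hrp := M.ofReal_scale_rpow hp hx
  have hprob := M.isProbabilityMeasure_scaledLaw p x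
  have hsm : ∀ i, Measurable fun z => (M.scale p x)⁻¹ • M.step (empirical x) (x i) z :=
    fun i => (M.measurable_step_const x i).const_smul (M.scale p x)⁻¹
  have hpi : (Measure.pi fun _ : Fin N => (M.θ : Measure (E m))).map
      (fun z i => (M.scale p x)⁻¹ • M.step (empirical x) (x i) (z i)) =
      Measure.pi (M.scaledLaw p x) :=
    Measure.pi_map_pi (hμ := fun i => have := hprob i; inferInstanceAs
      (SigmaFinite (M.scaledLaw p x i))) fun i => (hsm i).aemeasurable
  have hg : Measurable fun y : Fin N → E d => gap R h L y (M.scaledLaw p x) ^ p :=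
    ((measurable_gap R h L).comp (measurable_id.prodMk measurable_const)).pow_const p
  have hfm : Measurable fun (z : Fin N → E m) i =>
      (M.scale p x)⁻¹ • M.step (empirical x) (x i) (z i) :=
    measurable_pi_lambda _ fun i => (hsm i).comp (measurable_pi_apply i)
  have hmom : ∑ i, (N : ℝ≥0∞)⁻¹ * ∫⁻ v, ‖v‖ₑ ^ p ∂(M.scaledLaw p x i) ≤ 1 := by
    have e : ∀ i, ∫⁻ v, ‖v‖ₑ ^ p ∂(M.scaledLaw p x i) = (M.nextAvgPow p x + 1)⁻¹ *
        ∫⁻ z, ‖M.step (empirical x) (x i) z‖ₑ ^ p ∂(M.θ : Measure (E m)) := by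
      intro i
      have hn := M.measurable_step_const x i
      rw [scaledLaw, lintegral_map (by fun_prop) (hsm i), ← lintegral_const_mul _ (by fun_prop)]
      refine lintegral_congr fun z => ?_
      rw [enorm_smul, ENNReal.mul_rpow_of_nonneg _ _ hp.le, ← hrp,
        Real.enorm_eq_ofReal (inv_nonneg.2 hr0.le), ENNReal.ofReal_inv_of_pos hr0,
        ENNReal.inv_rpow]
    calc ∑ i, (N : ℝ≥0∞)⁻¹ * ∫⁻ v, ‖v‖ₑ ^ p ∂(M.scaledLaw p x i)
        = (M.nextAvgPow p x + 1)⁻¹ * M.nextAvgPow p x := by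
          conv_rhs => rw [nextAvgPow, Finset.mul_sum]
          refine Finset.sum_congr rfl fun i _ => ?_
          rw [e i, mul_left_comm]
          rfl
      _ ≤ (M.nextAvgPow p x + 1)⁻¹ * (M.nextAvgPow p x + 1) := by gcongr; exact le_self_add
      _ ≤ 1 := ENNReal.inv_mul_le_one _
  have hle := hgap (M.scaledLaw p x) hmom
  rw [← hpi, lintegral_map hg hfm] at hle
  unfold stepGap
  simp_rw [ENNReal.mul_rpow_of_nonneg _ _ hp.le]
  have hgf : Measurable fun z : Fin N → E m => gap R h L
      (fun i => (M.scale p x)⁻¹ • M.step (empirical x) (x i) (z i)) (M.scaledLaw p x) ^ p :=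
    hg.comp hfm
  rw [lintegral_const_mul _ hgf, hrp]
  gcongr

end OneStep

/-! ### Uniform moments and the one-step tail -/

section ParticleSystem

variable {d m N : ℕ} [NeZero N] {M : Model d m} {μ₀ : ProbabilityMeasure (E d)}
  {Ω : Type*} [MeasurableSpace Ω] {P : Measure Ω}
  {X : ℕ → Fin N → Ω → E d} {ξ : ℕ → Fin N → Ω → E m}

theorem IsParticleSystem.lintegral_position_noise [IsProbabilityMeasure P]
    (h : M.IsParticleSystem μ₀ P X ξ) (n : ℕ)
    {Φ : (Fin N → E d) × (Fin N → E m) → ℝ≥0∞} (hΦ : Measurable Φ) :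
    ∫⁻ w, Φ ((fun i => X n i w), fun i => ξ n i w) ∂P =
      ∫⁻ w, ∫⁻ z, Φ ((fun i => X n i w), z)
        ∂(Measure.pi fun _ : Fin N => (M.θ : Measure (E m))) ∂P := by
  have hX : Measurable fun w i => X n i w := measurable_pi_lambda _ fun i => h.measurable n i
  have hξ : Measurable fun w i => ξ n i w :=
    measurable_pi_lambda _ fun i => h.measurable_noise n i
  rw [← lintegral_map hΦ (hX.prodMk hξ), h.map_position_noise n, lintegral_prod _ hΦ.aemeasurable,
    lintegral_map hΦ.lintegral_prod_right' hX]

theorem IsParticleSystem.lintegral_avgPow_succ [IsProbabilityMeasure P]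
    (h : M.IsParticleSystem μ₀ P X ξ) (n : ℕ) (p : ℝ) :
    ∫⁻ w, avgPow p (fun i => X (n + 1) i w) ∂P =
      ∫⁻ w, M.nextAvgPow p (fun i => X n i w) ∂P := by
  have hm : ∀ i, Measurable fun q : (Fin N → E d) × (Fin N → E m) =>
      ‖M.step (empirical q.1) (q.1 i) (q.2 i)‖ₑ ^ p := fun i =>
    (M.measurable_step_comp (measurable_empirical.comp measurable_fst)
      ((measurable_pi_apply i).comp measurable_fst)
      ((measurable_pi_apply i).comp measurable_snd)).enorm.pow_const p
  have h₁ := h.lintegral_position_noise n (Φ := fun q => ∑ i, (N : ℝ≥0∞)⁻¹ *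
    ‖M.step (empirical q.1) (q.1 i) (q.2 i)‖ₑ ^ p)
    (Finset.measurable_fun_sum _ fun i _ => (hm i).const_mul _)
  simp only [avgPow, h.dynamics]
  refine h₁.trans (lintegral_congr fun w => ?_)
  have hs : ∀ i : Fin N, Measurable fun z : E m =>
      ‖M.step (empirical fun j => X n j w) (X n i w) z‖ₑ ^ p := fun i =>
    (M.measurable_step_const (fun j => X n j w) i).enorm.pow_const p
  have hs' : ∀ i : Fin N, Measurable fun z : Fin N → E m =>
      ‖M.step (empirical fun j => X n j w) (X n i w) (z i)‖ₑ ^ p := fun i =>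
    (hs i).comp (measurable_pi_apply i)
  dsimp only
  rw [lintegral_finsetSum _ fun i _ => (hs' i).const_mul _]
  refine Finset.sum_congr rfl fun i _ => ?_
  rw [lintegral_const_mul _ (hs' i),
    lintegral_eval_pi (fun _ : Fin N => (M.θ : Measure (E m))) i (hs i)]

theorem IsParticleSystem.lintegral_avgPow_zero (h : M.IsParticleSystem μ₀ P X ξ) (p : ℝ) :
    ∫⁻ w, avgPow p (fun i => X 0 i w) ∂P = ∫⁻ x, ‖x‖ₑ ^ p ∂(μ₀ : Measure (E d)) := by
  have hX := h.measurable 0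
  unfold avgPow
  rw [lintegral_finsetSum _ (by fun_prop)]
  have e : ∀ i, ∫⁻ w, (N : ℝ≥0∞)⁻¹ * ‖X 0 i w‖ₑ ^ p ∂P =
      (N : ℝ≥0∞)⁻¹ * ∫⁻ x, ‖x‖ₑ ^ p ∂(μ₀ : Measure (E d)) := by
    intro i
    rw [lintegral_const_mul _ (by fun_prop), ← h.law_init i,
      lintegral_map (by fun_prop) (hX i)]
  simp_rw [e]
  rw [← Finset.sum_mul, sum_inv_card, one_mul]

theorem le_add_mul_inv_of_recursion {u : ℕ → ℝ≥0∞} {k c : ℝ≥0∞} (hk : k < 1)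
    (hu : ∀ n, u (n + 1) ≤ k * u n + c) (n : ℕ) : u n ≤ u 0 + c * (1 - k)⁻¹ := by
  induction n with
  | zero => exact le_self_add
  | succ n ih =>
    have h1 : k * (1 - k)⁻¹ + 1 = (1 - k)⁻¹ := by
      have h2 : (1 - k) * (1 - k)⁻¹ = 1 :=
        ENNReal.mul_inv_cancel (tsub_pos_of_lt hk).ne' (by simp)
      calc k * (1 - k)⁻¹ + 1 = k * (1 - k)⁻¹ + (1 - k) * (1 - k)⁻¹ := by rw [h2]
        _ = (1 - k)⁻¹ := by rw [← add_mul, add_tsub_cancel_of_le hk.le, one_mul]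
    calc u (n + 1) ≤ k * (u 0 + c * (1 - k)⁻¹) + c := (hu n).trans (by gcongr)
      _ = k * u 0 + c * (k * (1 - k)⁻¹ + 1) := by ring
      _ ≤ 1 * u 0 + c * (1 - k)⁻¹ := by rw [h1]; gcongr
      _ = _ := by rw [one_mul]

/-- The moments of the particles are bounded uniformly in time and in the number of particles. -/
theorem exists_avgPow_bound {d m : ℕ} (hd : 1 ≤ d) (M : Model d m)
    (μ₀ : ProbabilityMeasure (E d)) {ω α : ℝ} (hA : ‖M.opA‖ ≤ Real.exp (-ω)) (hα : 0 < α)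
    (hmom : M.MomentAssumption α μ₀) (ha : 0 < M.a ω α) (hδ0 : 0 < M.δ)
    (hδ : M.δ < M.a ω α ^ (1 / (1 + α))) :
    ∃ Q : ℝ≥0∞, Q ≠ ∞ ∧ ∀ N : ℕ, ∀ [NeZero N], ∀ (Ω : Type*) [MeasurableSpace Ω] (P : Measure Ω)
      [IsProbabilityMeasure P] (X : ℕ → Fin N → Ω → E d) (ξ : ℕ → Fin N → Ω → E m),
      M.IsParticleSystem μ₀ P X ξ → ∀ n,
        ∫⁻ w, avgPow (1 + α) (fun i => X n i w) ∂P ≤ Q := by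
  have hk := M.moment_factor_lt_one hα hmom ha hδ0 hδ
  set k := 4 ^ α * (ENNReal.ofReal (Real.exp (-ω)) ^ (1 + α) +
    2 * (ENNReal.ofReal M.δ ^ (1 + α) * ∫⁻ z, M.D z ^ (1 + α) ∂(M.θ : Measure (E m)))) with hkdef
  set c := 4 ^ α * (ENNReal.ofReal M.δ ^ (1 + α) *
        ∫⁻ z, M.D₁ z ^ (1 + α) ∂(M.θ : Measure (E m))) with hcdef
  have hc : c ≠ ∞ := ENNReal.mul_ne_top (ENNReal.rpow_ne_top_of_nonneg hα.le (by simp))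
    (ENNReal.mul_ne_top (ENNReal.rpow_ne_top_of_nonneg (by linarith) (by simp)) hmom.base.ne)
  refine ⟨(∫⁻ x, ‖x‖ₑ ^ (1 + α) ∂(μ₀ : Measure (E d))) + c * (1 - k)⁻¹,
    ENNReal.add_ne_top.2 ⟨hmom.init.ne, ENNReal.mul_ne_top hc
      (ENNReal.inv_ne_top.2 (tsub_pos_of_lt hk).ne')⟩, fun N _ Ω _ P _ X ξ h n => ?_⟩
  rw [← h.lintegral_avgPow_zero (1 + α)]
  refine le_add_mul_inv_of_recursion (u := fun n => ∫⁻ w, avgPow (1 + α) (fun i => X n i w) ∂P) hk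
    (fun n => ?_) n
  rw [h.lintegral_avgPow_succ]
  refine (lintegral_mono fun w => M.nextAvgPow_le hd hA hδ0.le hα hmom _).trans_eq ?_
  have hX := h.measurable n
  have hm : Measurable fun w => avgPow (1 + α) (fun i => X n i w) := by
    unfold avgPow; fun_prop
  rw [lintegral_add_right _ measurable_const, lintegral_const_mul _ hm]
  simp [hkdef, hcdef]

theorem nextAvgPow_ne_top (hd : 1 ≤ d) {ω α : ℝ} (hA : ‖M.opA‖ ≤ Real.exp (-ω))
    (hα : 0 < α) (hmom : M.MomentAssumption α μ₀) (ha : 0 < M.a ω α) (hδ0 : 0 < M.δ)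
    (hδ : M.δ < M.a ω α ^ (1 / (1 + α))) (x : Fin N → E d) : M.nextAvgPow (1 + α) x ≠ ∞ := by
  refine ne_top_of_le_ne_top ?_ (M.nextAvgPow_le hd hA hδ0.le hα hmom x)
  have hp : 0 ≤ 1 + α := by linarith
  refine ENNReal.add_ne_top.2 ⟨ENNReal.mul_ne_top
    ((M.moment_factor_lt_one hα hmom ha hδ0 hδ).trans ENNReal.one_lt_top).ne ?_, ?_⟩
  · refine ENNReal.sum_ne_top.2 fun i _ => ENNReal.mul_ne_top ?_
      (ENNReal.rpow_ne_top_of_nonneg hp (by simp))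
    rw [ENNReal.inv_ne_top]
    exact_mod_cast NeZero.ne N
  · exact ENNReal.mul_ne_top (ENNReal.rpow_ne_top_of_nonneg hα.le (by simp))
      (ENNReal.mul_ne_top (ENNReal.rpow_ne_top_of_nonneg hp (by simp)) hmom.base.ne)

/-- A measurable majorant `G` is supplied so that Markov's inequality can be applied without
measurability of the Wasserstein distance along the system. -/
theorem IsParticleSystem.exists_measurable_bound [IsProbabilityMeasure P] (hd : 1 ≤ d) {ω α : ℝ}
    (hA : ‖M.opA‖ ≤ Real.exp (-ω)) (hα : 0 < α) (hmom : M.MomentAssumption α μ₀)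
    (ha : 0 < M.a ω α) (hδ0 : 0 < M.δ) (hδ : M.δ < M.a ω α ^ (1 / (1 + α)))
    (h : M.IsParticleSystem μ₀ P X ξ) {R l : ℝ} {L : ℕ} (hl : 0 < l) (hL : R ≤ L * l)
    {B Q : ℝ≥0∞}
    (hgap : ∀ ν : Fin N → Measure (E d), ∀ [∀ i, IsProbabilityMeasure (ν i)],
        ∑ i, (N : ℝ≥0∞)⁻¹ * ∫⁻ v, ‖v‖ₑ ^ (1 + α) ∂ν i ≤ 1 →
        ∫⁻ y, gap R l L y ν ^ (1 + α) ∂(Measure.pi ν) ≤ B)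
    (n : ℕ) (hQ : ∫⁻ w, avgPow (1 + α) (fun i => X (n + 1) i w) ∂P ≤ Q) :
    ∃ G : Ω → ℝ≥0∞, Measurable G ∧ ∫⁻ w, G w ∂P ≤ (Q + 1) * B ∧
      ∀ w, W1 (empirical fun i => X (n + 1) i w) (M.Psi (empirical fun i => X n i w)) ^ (1 + α)
        ≤ G w := by
  have hp : 0 < 1 + α := by linarith
  have hX : Measurable fun w i => X n i w := measurable_pi_lambda _ fun i => h.measurable n i
  have hξ : Measurable fun w i => ξ n i w :=
    measurable_pi_lambda _ fun i => h.measurable_noise n i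
  let Φ : (Fin N → E d) × (Fin N → E m) → ℝ≥0∞ := fun q =>
    M.stepGap (1 + α) R l L q.1 q.2 ^ (1 + α)
  have hΦ : Measurable Φ := (M.measurable_stepGap (N := N) (1 + α) R l L).pow_const (1 + α)
  have hnm : Measurable fun w => M.nextAvgPow (1 + α) (fun i => X n i w) :=
    (M.measurable_nextAvgPow (1 + α)).comp hX
  refine ⟨fun w => Φ ((fun i => X n i w), fun i => ξ n i w), hΦ.comp (hX.prodMk hξ), ?_,
    fun w => ?_⟩
  · rw [h.lintegral_position_noise n hΦ]
    calc ∫⁻ w, ∫⁻ z, Φ ((fun i => X n i w), z)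
          ∂(Measure.pi fun _ : Fin N => (M.θ : Measure (E m))) ∂P
        ≤ ∫⁻ w, (M.nextAvgPow (1 + α) (fun i => X n i w) + 1) * B ∂P :=
          lintegral_mono fun w => M.lintegral_stepGap_rpow_le hp hgap
            (nextAvgPow_ne_top hd hA hα hmom ha hδ0 hδ _)
      _ ≤ (Q + 1) * B := by
          rw [lintegral_mul_const _ (by fun_prop), lintegral_add_right _ measurable_const,
            ← h.lintegral_avgPow_succ]
          simp only [lintegral_const, measure_univ, mul_one]
          gcongr
  · refine ENNReal.rpow_le_rpow ?_ hp.le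
    have e : (fun i => X (n + 1) i w) =
        fun i => M.step (empirical fun j => X n j w) (X n i w) (ξ n i w) :=
      funext fun i => h.dynamics n i w
    rw [e]
    exact M.W1_le_stepGap hl hL _ _

/-- The one-step fluctuation of the empirical measure. -/
theorem exists_one_step_bound {d m : ℕ} (hd : 1 ≤ d) (M : Model d m)
    (μ₀ : ProbabilityMeasure (E d)) {ω α : ℝ} (hA : ‖M.opA‖ ≤ Real.exp (-ω)) (hα : 0 < α)
    (hmom : M.MomentAssumption α μ₀) (ha : 0 < M.a ω α) (hδ0 : 0 < M.δ)
    (hδ : M.δ < M.a ω α ^ (1 / (1 + α))) :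
    ∃ C : ℝ, 0 < C ∧ ∀ N : ℕ, ∀ [NeZero N], ∀ (Ω : Type*) [MeasurableSpace Ω] (P : Measure Ω)
      [IsProbabilityMeasure P] (X : ℕ → Fin N → Ω → E d) (ξ : ℕ → Fin N → Ω → E m),
      M.IsParticleSystem μ₀ P X ξ → ∀ (n : ℕ) (η : ℝ), 0 < η →
        P.real {w | ENNReal.ofReal η < W1 (empirical fun i => X (n + 1) i w)
          (M.Psi (empirical fun i => X n i w))} ≤
        C * (N : ℝ) ^ (-(α / ((d : ℝ) + 2))) * η ^ (-(1 + α)) := by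
  obtain ⟨C, hC, hgap⟩ := exists_lintegral_gap_rpow_le d hα
  obtain ⟨Q, hQ, hmb⟩ := exists_avgPow_bound hd M μ₀ hA hα hmom ha hδ0 hδ
  have hp : 0 < 1 + α := by linarith
  refine ⟨(Q.toReal + 1) * C, by positivity, fun N _ Ω _ P _ X ξ h n η hη => ?_⟩
  obtain ⟨R, l, L, hl, hL, hg⟩ := hgap N
  set b : ℝ := (N : ℝ) ^ (-(α / ((d : ℝ) + 2))) with hb
  have hb0 : 0 ≤ b := by positivity
  obtain ⟨G, hGm, hG, hGW⟩ := h.exists_measurable_bound hd hA hα hmom ha hδ0 hδ hl hL hg n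
    (hmb N Ω P X ξ h (n + 1))
  have hη' : ENNReal.ofReal η ^ (1 + α) = ENNReal.ofReal (η ^ (1 + α)) :=
    ENNReal.ofReal_rpow_of_pos hη
  have hηp : 0 < η ^ (1 + α) := Real.rpow_pos_of_pos hη _
  have hsub : P {w | ENNReal.ofReal η < W1 (empirical fun i => X (n + 1) i w)
      (M.Psi (empirical fun i => X n i w))} ≤ P {w | ENNReal.ofReal (η ^ (1 + α)) ≤ G w} := by
    refine measure_mono fun w hw => ?_
    change ENNReal.ofReal (η ^ (1 + α)) ≤ G w
    rw [← hη']
    exact (ENNReal.rpow_le_rpow (le_of_lt hw) hp.le).trans (hGW w)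
  have hfin : P {w | ENNReal.ofReal η < W1 (empirical fun i => X (n + 1) i w)
      (M.Psi (empirical fun i => X n i w))} ≤
      ENNReal.ofReal ((Q.toReal + 1) * C * b * η ^ (-(1 + α))) := by
    refine hsub.trans ((meas_ge_le_lintegral_div hGm.aemeasurable (by simpa using hηp)
      (by simp)).trans ((ENNReal.div_le_div_right hG _).trans_eq ?_))
    have hQ1 : Q + 1 = ENNReal.ofReal (Q.toReal + 1) := by
      rw [ENNReal.ofReal_add (by positivity) zero_le_one, ENNReal.ofReal_toReal hQ,
        ENNReal.ofReal_one]
    rw [hQ1, ← ENNReal.ofReal_mul (by positivity), ← ENNReal.ofReal_div_of_pos hηp,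
      Real.rpow_neg hη.le, div_eq_mul_inv]
    congr 1; ring
  exact ENNReal.toReal_le_of_le_ofReal (by positivity) hfin

/-- If the sampling error is at most `a` and the old error at most `b`, the new error is at most `a
+ κb`. The union bound needs no measurability of the events. -/
theorem tail_succ_le [IsProbabilityMeasure P] (hd : 1 ≤ d) {ω α : ℝ} (hA : ‖M.opA‖ ≤ Real.exp (-ω))
    (hδ : 0 ≤ M.δ) (hα : 0 < α) (hmom : M.MomentAssumption α μ₀)
    (n : ℕ) {a b ε : ℝ} (ha : 0 ≤ a) (hb : 0 ≤ b)
    (hε : a + (Real.exp (-ω) + 2 * M.δ * M.σ) * b = ε) :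
    P.real {w | ENNReal.ofReal ε < W1 (empirical fun i => X (n + 1) i w) (M.law μ₀ (n + 1))} ≤
      P.real {w | ENNReal.ofReal a < W1 (empirical fun i => X (n + 1) i w)
          (M.Psi (empirical fun i => X n i w))}
        + P.real {w | ENNReal.ofReal b < W1 (empirical fun i => X n i w) (M.law μ₀ n)} := by
  have hσ0 : 0 ≤ M.σ := ENNReal.toReal_nonneg
  refine le_trans (measureReal_mono ?_ (by simp)) (measureReal_union_le _ _)
  intro w hw
  by_contra hcon
  simp only [Set.mem_union, Set.mem_ofPred_eq, not_or, not_lt] at hcon hw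
  refine absurd hw (not_lt.2 ?_)
  refine (W1_triangle _ (M.Psi (empirical fun i => X n i w)) _).trans ?_
  refine (add_le_add hcon.1 ((M.W1_Psi_le hd hA hδ hα hmom (finiteFirstMoment_empirical _)
    (M.finiteFirstMoment_law hd hA hδ hα hmom n)).trans (mul_le_mul_right hcon.2 _))).trans_eq ?_
  rw [← ENNReal.ofReal_mul (by positivity), ← ENNReal.ofReal_add ha (by positivity), hε]

end ParticleSystem

end Model

end WeakInteraction

/-! ### Iteration in time -/

theorem theorem3p7 {d m : ℕ} (hd : 1 ≤ d) (M : WeakInteraction.Model d m)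
    (μ₀ : ProbabilityMeasure (WeakInteraction.E d))
    (ω α γ₀ : ℝ) (hω : 0 < ω) (hA : ‖M.opA‖ ≤ Real.exp (-ω))
    (hα : 0 < α) (hmom : M.MomentAssumption α μ₀)
    (hσ : 0 < M.σ)
    (hγ₀ : γ₀ ∈ Set.Ioo 0 (M.a₀ ω))
    (ha : 0 < M.a ω α)
    (hδ : M.δ ∈ Set.Ioo 0 (min ((M.a ω α) ^ (1 / (1 + α))) (M.a₀ ω - γ₀))) :
    ∃ N₀ : ℕ, ∃ C₁ : ℝ, 0 < C₁ ∧
      ∀ ε : ℝ, 0 < ε → ∀ n N : ℕ, ∀ [NeZero N],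
        (N₀ : ℝ) * (max 1 (Real.posLog ε)) ^ (((d : ℝ) + 2) / d) < N →
        ∀ (Ω : Type*) [MeasurableSpace Ω] (P : Measure Ω) [IsProbabilityMeasure P]
          (X : ℕ → Fin N → Ω → WeakInteraction.E d) (ξ : ℕ → Fin N → Ω → WeakInteraction.E m),
          M.IsParticleSystem μ₀ P X ξ →
          P.real {w | ENNReal.ofReal ε <
              WeakInteraction.W1 (WeakInteraction.empirical fun i => X n i w) (M.law μ₀ n)}
            ≤ P.real {w | ENNReal.ofReal (2 * M.σ * γ₀ * M.vartheta ω γ₀ ^ n * ε) <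
                WeakInteraction.W1 (WeakInteraction.empirical fun i => X 0 i w) μ₀}
              + C₁ * ε ^ (-(1 + α)) * (N : ℝ) ^ (-(α / ((d : ℝ) + 2))) := by
  obtain ⟨hδ0, hδ1⟩ := hδ
  have hδa : M.δ < M.a ω α ^ (1 / (1 + α)) := hδ1.trans_le (min_le_left _ _)
  have hδa₀ : M.δ < M.a₀ ω - γ₀ := hδ1.trans_le (min_le_right _ _)
  have hp : 0 < 1 + α := by linarith
  have he : Real.exp (-ω) < 1 := Real.exp_zero ▸ Real.exp_lt_exp.2 (by linarith)
  have he0 : 0 < Real.exp (-ω) := Real.exp_pos _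
  have ha₀ : 2 * M.σ * M.a₀ ω = 1 - Real.exp (-ω) := by
    unfold WeakInteraction.Model.a₀; field_simp
  set g := 2 * M.σ * γ₀ with hg
  set κ := Real.exp (-ω) + 2 * M.δ * M.σ with hκ
  set ϑ := M.vartheta ω γ₀ with hϑ
  have hκ0 : 0 < κ := by positivity
  have hg0 : 0 < g := mul_pos (by positivity) hγ₀.1
  have hg1 : g < 1 := by nlinarith [hγ₀.2]
  -- This is `δ < a₀ - γ₀` multiplied by `2σ`; it makes `ϑ > 1`.
  have hκg : κ < 1 - g := by nlinarith
  have hκϑ : κ * ϑ = 1 - g := by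
    rw [hϑ, WeakInteraction.Model.vartheta, ← hκ, ← hg]; field_simp
  have hϑ1 : 1 < ϑ := by
    by_contra hcon
    nlinarith
  have hϑ0 : 0 < ϑ := by linarith
  -- Each step back in time multiplies the level by `ϑ`, hence the sampling tail by `q`.
  set q := ϑ ^ (-(1 + α)) with hq
  have hq0 : 0 < q := Real.rpow_pos_of_pos hϑ0 _
  have hq1 : q < 1 := Real.rpow_lt_one_of_one_lt_of_neg hϑ1 (by linarith)
  obtain ⟨C, hC, hstep⟩ :=
    WeakInteraction.Model.exists_one_step_bound hd M μ₀ hA hα hmom ha hδ0 hδa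
  have hgp : 0 < g ^ (-(1 + α)) := Real.rpow_pos_of_pos hg0 _
  have h1q : 0 < 1 - q := by linarith
  -- The one-step bound needs no lower bound on `N`, so `N₀ = 0` is admissible.
  refine ⟨0, C * g ^ (-(1 + α)) * (1 - q)⁻¹, by positivity,
    fun ε hε n N _ _ Ω _ P _ X ξ hX => ?_⟩
  set b : ℝ := (N : ℝ) ^ (-(α / ((d : ℝ) + 2))) with hb
  have hb0 : 0 ≤ b := by positivity
  -- The level is quantified inside the induction, since the step at `ε` calls the hypothesis at `ϑ
  -- * ε`.
  have key : ∀ (n : ℕ) (ε : ℝ), 0 < ε →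
      P.real {w | ENNReal.ofReal ε <
          WeakInteraction.W1 (WeakInteraction.empirical fun i => X n i w) (M.law μ₀ n)}
        ≤ P.real {w | ENNReal.ofReal (ϑ ^ n * ε) <
            WeakInteraction.W1 (WeakInteraction.empirical fun i => X 0 i w) μ₀}
          + C * b * g ^ (-(1 + α)) * ε ^ (-(1 + α)) * ∑ k ∈ Finset.range n, q ^ k := by
    intro n
    induction n with
    | zero => intro ε _; simp [WeakInteraction.Model.law]
    | succ n ih =>
      intro ε hε
      have h₁ := WeakInteraction.Model.tail_succ_le (P := P) (X := X) hd hA hδ0.le hα hmom n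
        (a := g * ε) (b := ϑ * ε) (ε := ε) (by positivity) (by positivity)
        (by rw [← mul_assoc, hκϑ]; ring)
      have h₂ := hstep N Ω P X ξ hX n (g * ε) (by positivity)
      have h₃ := ih (ϑ * ε) (by positivity)
      rw [Real.mul_rpow hg0.le hε.le] at h₂
      rw [Real.mul_rpow hϑ0.le hε.le, ← hq, ← mul_assoc (ϑ ^ n), ← pow_succ] at h₃
      rw [Finset.sum_range_succ', pow_zero]
      simp_rw [pow_succ q]
      rw [← Finset.sum_mul]
      refine h₁.trans ((add_le_add h₂ h₃).trans_eq ?_)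
      ring
  refine (key n ε hε).trans (add_le_add ?_ ?_)
  -- The induction gives the larger initial threshold `ϑ ^ n * ε`; as `g < 1`, inserting `g` only
  -- enlarges the event.
  · refine measureReal_mono (fun w hw => lt_of_le_of_lt (ENNReal.ofReal_le_ofReal ?_) hw) (by simp)
    have : 0 < ϑ ^ n * ε := by positivity
    rw [mul_assoc]
    nlinarith
  · have hsum : ∑ k ∈ Finset.range n, q ^ k ≤ (1 - q)⁻¹ := by
      rw [← tsum_geometric_of_lt_one hq0.le hq1]
      exact (summable_geometric_of_lt_one hq0.le hq1).sum_le_tsum _ fun _ _ => by positivity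
    have hεp : 0 < ε ^ (-(1 + α)) := Real.rpow_pos_of_pos hε _
    calc C * b * g ^ (-(1 + α)) * ε ^ (-(1 + α)) * ∑ k ∈ Finset.range n, q ^ k
        ≤ C * b * g ^ (-(1 + α)) * ε ^ (-(1 + α)) * (1 - q)⁻¹ := by gcongr
      _ = _ := by ring
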